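/- **Setting.** Let $\alpha>1/2$, let $\gamma_1,\gamma_2,\ldots\in(0,1]$ and let $\delta\in(0,1)$. For $d\in\mathbb N$ and $\boldsymbol h\in\mathbb Z^d$ put $r_{2\alpha,\boldsymbol\gamma}(\boldsymbol h)=\prod_{j=1}^d\max\{|h_j|^{2\alpha}/\gamma_j,1\}$. The weighted Korobov space $\mathcal H_{d,\alpha,\boldsymbol\gamma}$ consists of the continuous functions $f:\mathbb R^d\to\mathbb C$, one-periodic in each variable, with $\|f\|_{d,\alpha,\boldsymbol\gamma}^2:=\sum_{\boldsymbol h\in\mathbb Z^d}|\widehat f(\boldsymbol h)|^2\,r_{2\alpha,\boldsymbol\gamma}(\boldsymbol h)<\infty$, where $\widehat f(\boldsymbol h)=\int_{[0,1]^d}f(\boldsymbol x)e^{-2\pi \mathrm i\boldsymbol h\cdot\boldsymbol x}\,d\boldsymbol x$. **Algorithm.** For a prime $N$ and $\tau>0$ put $$P_N(\tau)=\prod_{j=1}^d\bigl(1+2\gamma_j^{1/(2\alpha)}(1+\tau\log N)\bigr),\qquad N_*(\tau)=\frac{N-1}{\exp(\tau^{-1})P_N(\tau)},\qquad \mathcal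 A=\{\boldsymbol h\in\mathbb Z^d: r_{2\alpha,\boldsymbol\gamma}(\boldsymbol h)\le N_*(\tau)^{2\alpha}\}.$$ For an odd $R$ draw independently $\boldsymbol z_1,\ldots,\boldsymbol z_R$ uniformly from $\{1,\ldots,N-1\}^d$ and $\boldsymbol\Delta_1,\ldots,\boldsymbol\Delta_R$ uniformly from $[0,1)^d$. For $\boldsymbol h\in\mathcal A$ let $\widetilde f(\boldsymbol h)$ be the median (taken separately in real and imaginary parts) over $r=1,\ldots,R$ of $$\frac1N\sum_{k=0}^{N-1}f\Bigl(\frac{k\boldsymbol z_r}N+\boldsymbol\Delta_r\Bigr)\exp\Bigl(-2\pi \mathrm i\,\boldsymbol h\cdot\Bigl(\frac{k\boldsymbol z_r}N+\boldsymbol\Delta_r\Bigr)\Bigr),$$ and let $A^{\mathrm{rand}}(f)(\boldsymbol x)=\sum_{\boldsymbol h\in\mathcal A}\widetilde f(\boldsymbol h)e^{2\pi \mathrm i\boldsymbol h\cdot\boldsymbol x}$. This uses $M=RN$ evaluations of $f$. Its randomized error is $$\mathrm{err}^{\mathrm{ran}}=\sup_{\|f\|_{d,\alpha,\boldsymbol\gamma}\le1}\Bigl(\mathbb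 E\,\|f-A^{\mathrm{rand}}(f)\|_{L_2([0,1]^d)}^2\Bigr)^{1/2}.$$ **Parameter choice.** Put $\rho(N)=2\log\bigl(1+\frac{N-1}{4e}\bigr)+2\log(\delta^{-1})$. Given a budget $M_{\max}\in\mathbb N$, the triple $(N,R,\tau)$ is *chosen for $(d,M_{\max})$* if * $N$ is the largest prime with $N(\rho(N)+1)\le M_{\max}$; * $R$ is an odd positive integer with $\rho(N)-1\le R\le\rho(N)+1$; * $\tau$ maximizes $N_*(\tau)$ among all $\tau>0$ satisfying $N\ge P_N(\tau)\exp\bigl(e(4\tau^{-1}+4)\bigr)+1$. **Theorem.** 1. For every $d\ge1$ there is $B_0$ such that a choice $(N,R,\tau)$ exists for every $M_{\max}\ge B_0$; and for every $\varepsilon>0$ there is a constant $C$ such that every choice (for every $M_{\max}$) satisfies $$\mathrm{err}^{\mathrm{ran}}\le C\,M^{-\alpha+\varepsilon},\qquad M=RN.$$ 2. If $\sum_{j=1}^\infty\gamma_j^{1/(2\alpha)}<\infty$, then $B_0$ and (for each $\varepsilon$) $C$ in part 1 can be taken independent of $d$. 3. If $\limsup_{d\to\infty}\bigl(\sum_{j=1}^d\gamma_j^{1/(2\alpha)}\bigr)/\log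 d<\infty$, then in part 1 they can be taken polynomial in $d$: there are $b_0$ and $q_0\in\mathbb N$ such that $B_0=b_0d^{q_0}$ works for all $d\ge 1$, and for every $\varepsilon>0$ there are $c$ and $q\in\mathbb N$ such that $C=c\,d^{q}$ works for all $d\ge1$. The constants may depend on $\alpha,(\gamma_j)_j,\delta$ (and $C,c,q$ on $\varepsilon$); in part 1 also on $d$. -/

import Mathlib

open MeasureTheory ProbabilityTheory UnitAddTorus Filter
open scoped ENNReal

noncomputable section

namespace MedianLattice

/-- The normalised Haar measure on the torus `(ℝ/ℤ)^d`, i.e. the uniform distribution (Lebesgue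
measure) on `[0,1)^d`. -/
def torusMeasure (d : ℕ) : Measure (UnitAddTorus (Fin d)) :=
  Measure.pi fun _ => AddCircle.haarAddCircle

/-- `r_{2α,γ}(h) = ∏_{j=1}^d max (|h_j|^{2α} / γ_j, 1)`. The weights are indexed from `0`, i.e.
`γ j` is the weight of the `(j+1)`-st variable. -/
def r (α : ℝ) (γ : ℕ → ℝ) {d : ℕ} (h : Fin d → ℤ) : ℝ :=
  ∏ j : Fin d, max (|(h j : ℝ)| ^ (2 * α) / γ j) 1

/-- A continuous one-periodic function (a continuous function on the torus) belongs to the weighted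
Korobov space iff `∑_h |f̂(h)|² r_{2α,γ}(h) < ∞`. For `α > 1/2` these functions are exactly the
elements of the reproducing kernel Hilbert space, being the pointwise sums of their absolutely
convergent Fourier series. -/
def MemKorobov (α : ℝ) (γ : ℕ → ℝ) {d : ℕ} (f : C(UnitAddTorus (Fin d), ℂ)) : Prop :=
  Summable fun h : Fin d → ℤ => ‖mFourierCoeff f h‖ ^ 2 * r α γ h

/-- The norm of the weighted Korobov space. -/
def korobovNorm (α : ℝ) (γ : ℕ → ℝ) {d : ℕ} (f : C(UnitAddTorus (Fin d), ℂ)) : ℝ :=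
  Real.sqrt (∑' h : Fin d → ℤ, ‖mFourierCoeff f h‖ ^ 2 * r α γ h)

/-- The closed unit ball of the weighted Korobov space. -/
def korobovBall (α : ℝ) (γ : ℕ → ℝ) (d : ℕ) : Set C(UnitAddTorus (Fin d), ℂ) :=
  {f | MemKorobov α γ f ∧ korobovNorm α γ f ≤ 1}

/-- The frequency set `A_d(L) = {h ∈ ℤ^d : r_{2α,γ}(h) ≤ L^{2α}}`. -/
def freqSet (α : ℝ) (γ : ℕ → ℝ) (d : ℕ) (L : ℝ) : Set (Fin d → ℤ) :=
  {h | r α γ h ≤ L ^ (2 * α)}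

/-- The frequency sets are finite, so that the finite sum over `freqSet` below is a genuine one. -/
theorem freqSet_finite {α : ℝ} (hα : 1 / 2 < α) {γ : ℕ → ℝ} (hγ : ∀ j, 0 < γ j ∧ γ j ≤ 1)
    (d : ℕ) {L : ℝ} (hL : 0 ≤ L) : (freqSet α γ d L).Finite := by
  refine (Set.Finite.pi' (t := fun _ : Fin d => Set.Icc (-⌈L⌉) ⌈L⌉)
    fun _ => Set.finite_Icc _ _).subset ?_
  intro h hh j
  have h1 : max (|(h j : ℝ)| ^ (2 * α) / γ j) 1 ≤ r α γ h := by
    unfold r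
    rw [← Finset.mul_prod_erase _ _ (Finset.mem_univ j)]
    refine le_mul_of_one_le_right (le_trans zero_le_one (le_max_right _ _)) ?_
    exact Finset.one_le_prod fun i _ => le_max_right _ _
  have h2 : |(h j : ℝ)| ^ (2 * α) ≤ |(h j : ℝ)| ^ (2 * α) / γ j := by
    rw [le_div_iff₀ (hγ j).1]
    exact mul_le_of_le_one_right (by positivity) (hγ j).2
  have h3 : |(h j : ℝ)| ^ (2 * α) ≤ L ^ (2 * α) :=
    h2.trans ((le_max_left _ _).trans (h1.trans hh))
  have h4 : |(h j : ℝ)| ≤ L :=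
    (Real.rpow_le_rpow_iff (abs_nonneg _) hL (by linarith)).1 h3
  have h5 : |(h j : ℝ)| ≤ (⌈L⌉ : ℝ) := h4.trans (Int.le_ceil L)
  rw [abs_le] at h5
  exact ⟨by exact_mod_cast h5.1, by exact_mod_cast h5.2⟩

/-- `P_N(τ,d,γ) = ∏_{j=1}^d (1 + 2 γ_j^{1/(2α)} (1 + τ log N))`. -/
def P (α : ℝ) (γ : ℕ → ℝ) (d N : ℕ) (τ : ℝ) : ℝ :=
  ∏ j : Fin d, (1 + 2 * γ j ^ (1 / (2 * α)) * (1 + τ * Real.log N))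

/-- `N_* = (N - 1) / (exp(1/τ) P_N(τ,d,γ))`. -/
def Nstar (α : ℝ) (γ : ℕ → ℝ) (d N : ℕ) (τ : ℝ) : ℝ :=
  ((N : ℝ) - 1) / (Real.exp τ⁻¹ * P α γ d N τ)

/-- The median of an odd number `2m+1` of reals: the middle entry after sorting. -/
def realMedian {m : ℕ} (Z : Fin (2 * m + 1) → ℝ) : ℝ :=
  Z (Tuple.sort Z ⟨m, by omega⟩)

/-- The median of an odd number of complex numbers, taken separately in real and imaginary part. -/
def complexMedian {m : ℕ} (Z : Fin (2 * m + 1) → ℂ) : ℂ :=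
  ⟨realMedian fun i => (Z i).re, realMedian fun i => (Z i).im⟩

/-- The `k`-th point `k z / N + Δ` (modulo one) of the shifted rank-1 lattice. -/
def latticePoint {d : ℕ} (N : ℕ) (z : Fin d → ℕ) (Δ : UnitAddTorus (Fin d)) (k : ℕ) :
    UnitAddTorus (Fin d) :=
  fun j => (((k : ℝ) * z j / N : ℝ) : UnitAddCircle) + Δ j

/-- The shifted lattice rule approximating the `h`-th Fourier coefficient of `f`. -/
def coeffEstimate {d : ℕ} (N : ℕ) (f : C(UnitAddTorus (Fin d), ℂ))
    (ω : (Fin d → ℕ) × UnitAddTorus (Fin d)) (h : Fin d → ℤ) : ℂ :=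
  (1 / (N : ℂ)) * ∑ k ∈ Finset.range N,
    f (latticePoint N ω.1 ω.2 k) * mFourier (-h) (latticePoint N ω.1 ω.2 k)

/-- The output of the median lattice algorithm with `R = 2m+1` repetitions, given the generating
vectors and shifts `ω`. -/
def medianApprox (α : ℝ) (γ : ℕ → ℝ) {d : ℕ} (N m : ℕ) (τ : ℝ)
    (ω : Fin (2 * m + 1) → (Fin d → ℕ) × UnitAddTorus (Fin d))
    (f : C(UnitAddTorus (Fin d), ℂ)) (x : UnitAddTorus (Fin d)) : ℂ :=
  ∑ᶠ h ∈ freqSet α γ d (Nstar α γ d N τ),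
    complexMedian (fun i => coeffEstimate N f (ω i) h) * mFourier h x

/-- The law of the random input of the algorithm: `R = 2m+1` independent pairs of a generating
vector, uniform on `{1,…,N-1}^d`, and an independent shift, uniform on the torus. -/
def inputLaw (d N m : ℕ) :
    Measure (Fin (2 * m + 1) → (Fin d → ℕ) × UnitAddTorus (Fin d)) :=
  Measure.pi fun _ =>
    (uniformOn {z : Fin d → ℕ | ∀ j, 1 ≤ z j ∧ z j ≤ N - 1}).prod (torusMeasure d)

/-- The randomized error (worst-case root-mean-squared `L₂`-error over the unit ball of the Korobov
space) of the median lattice algorithm, as an extended nonnegative real. -/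
def randomizedError (α : ℝ) (γ : ℕ → ℝ) (d N m : ℕ) (τ : ℝ) : ℝ≥0∞ :=
  ⨆ f ∈ korobovBall α γ d,
    (∫⁻ ω, eLpNorm (fun x => f x - medianApprox α γ N m τ ω f x) 2 (torusMeasure d) ^ 2
      ∂inputLaw d N m) ^ (1 / 2 : ℝ)

/-- `2 log (1 + (N-1)/(4e)) + 2 log (1/δ)`, the centre of the range for the number of
repetitions. -/
def repCentre (δ : ℝ) (N : ℕ) : ℝ :=
  2 * Real.log (1 + ((N : ℝ) - 1) / (4 * Real.exp 1)) + 2 * Real.log δ⁻¹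

/-- `τ > 0` is admissible for `N`: `N ≥ P_N(τ,d,γ) exp ((4/τ + 4)/c) + 1` with `c = exp(-1)`. -/
def Admissible (α : ℝ) (γ : ℕ → ℝ) (d N : ℕ) (τ : ℝ) : Prop :=
  0 < τ ∧ P α γ d N τ * Real.exp ((4 * τ⁻¹ + 4) / Real.exp (-1)) + 1 ≤ N

/-- The parameter choice for a budget of `B` function evaluations: `N` is the largest prime with
`N (2 log (1 + (N-1)/(4e)) + 2 log (1/δ) + 1) ≤ B`, the number `2m+1` of repetitions lies within
distance one of `repCentre δ N`, and `τ` maximises `N_*` among the admissible values. -/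
structure IsParameterChoice (α : ℝ) (γ : ℕ → ℝ) (δ : ℝ) (d B N m : ℕ) (τ : ℝ) : Prop where
  isGreatest_prime : IsGreatest {p : ℕ | p.Prime ∧ (p : ℝ) * (repCentre δ p + 1) ≤ B} N
  repCentre_sub_one_le : repCentre δ N - 1 ≤ ((2 * m + 1 : ℕ) : ℝ)
  le_repCentre_add_one : ((2 * m + 1 : ℕ) : ℝ) ≤ repCentre δ N + 1
  admissible : Admissible α γ d N τ
  maximal : ∀ τ' : ℝ, Admissible α γ d N τ' → Nstar α γ d N τ' ≤ Nstar α γ d N τ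

end MedianLattice

end

noncomputable section

namespace MedianLattice

/-! ### Medians -/

/-! By Parseval the squared `L₂` error is the mass of `f̂` outside the frequency set `A`, at most
`N_*^{-2α}` on the unit ball, plus the squared errors of the medians over `h ∈ A`
(`eLpNorm_sub_medianApprox_sq`). Averaged over the shift, one lattice rule for `h` has as squared
error the sum of `|f̂(k)|²` over its aliases, the `k ≠ h` with `N ∣ (k - h)·z`.

Two facts about a random `z` control the aliases. `N_*` is tuned so that `|A| ≤ N - 1` and `A` has
no two frequencies congruent mod `N`, whence a fixed `k` aliases on average at most two `h ∈ A`
(`sum_generatorLaw_aliases_le`). And for a small `η` the core `A' = freqSet (η N_*)` has at most `η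
(N - 1)` elements, so a sample is bad for `h`, meaning that some alias lies in `A'`, with
probability at most `η` (`sampleLaw_badSamples_le`).

If most samples are good, the median is controlled by them, and they see only the mass outside `A'`,
which is `O(N_*^{-2α})`. Otherwise `m + 1` samples are bad; by independence this costs a factor
`2^{2m+1} η^m` (`lintegral_medianBound_le`). With `η = e^{-2α}/4` and `m ≥ log N - O(1)` that factor
is `O(N^{-2α})`. Hence the error is `O(R^{1/2} N_*^{-α})` with a constant free of `d`
(`randomizedError_le_sqrt_mul`).

It remains to see that the optimal `τ` gives `N_* ≥ c N^{1-ε}` (`rpow_le_mul_Nstar`), by comparison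
with one explicit `τ`; the logarithmic factor `R` is absorbed by `N^ε`. If `∑_{j<d} γ_j^{1/(2α)} ≤ K
T`, all dependence on `d` enters through factors `exp(qT)`. Taking `T = 1` settles fixed dimension
and summable weights, and `T = 1 + log d` turns these factors into powers of `d`. -/

theorem card_lt_add_card_of_sort {n : ℕ} (Z : Fin n → ℝ) (I G : Finset (Fin n))
    (h : n < I.card + G.card) : ∃ j ∈ I, Tuple.sort Z j ∈ G := by
  by_contra! hcon
  have hd : Disjoint (I.map (Tuple.sort Z).toEmbedding) G := by
    rw [Finset.disjoint_left]
    intro x hx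
    obtain ⟨j, hj, rfl⟩ := Finset.mem_map.1 hx
    exact hcon j hj
  have := Finset.card_le_univ ((I.map (Tuple.sort Z).toEmbedding) ∪ G)
  rw [Finset.card_union_of_disjoint hd, Finset.card_map, Fintype.card_fin] at this
  omega

/-- The middle entry and those after it in sorted order number `m + 1`, so by pigeonhole any
majority `G` meets them. -/
theorem exists_realMedian_le {m : ℕ} (Z : Fin (2 * m + 1) → ℝ) (G : Finset (Fin (2 * m + 1)))
    (hG : m + 1 ≤ G.card) : ∃ i ∈ G, realMedian Z ≤ Z i := by
  obtain ⟨j, hj, hjG⟩ := card_lt_add_card_of_sort Z (Finset.Ici ⟨m, by omega⟩) G (by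
    rw [Fin.card_Ici]; simp only; omega)
  exact ⟨_, hjG, Tuple.monotone_sort Z (Finset.mem_Ici.1 hj)⟩

theorem exists_le_realMedian {m : ℕ} (Z : Fin (2 * m + 1) → ℝ) (G : Finset (Fin (2 * m + 1)))
    (hG : m + 1 ≤ G.card) : ∃ i ∈ G, Z i ≤ realMedian Z := by
  obtain ⟨j, hj, hjG⟩ := card_lt_add_card_of_sort Z (Finset.Iic ⟨m, by omega⟩) G (by
    rw [Fin.card_Iic]; simp only; omega)
  exact ⟨_, hjG, Tuple.monotone_sort Z (Finset.mem_Iic.1 hj)⟩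

/-- A majority has members on both sides of the median, so one of them is at least as far from `c`.
A sum over `G` instead of a maximum lets real and imaginary parts, whose extremal samples may
differ, be added afterwards. -/
theorem sq_realMedian_sub_le {m : ℕ} (Z : Fin (2 * m + 1) → ℝ) (G : Finset (Fin (2 * m + 1)))
    (hG : m + 1 ≤ G.card) (c : ℝ) : (realMedian Z - c) ^ 2 ≤ ∑ i ∈ G, (Z i - c) ^ 2 := by
  have key : ∃ i ∈ G, (realMedian Z - c) ^ 2 ≤ (Z i - c) ^ 2 := by
    rcases le_total c (realMedian Z) with h | h
    · obtain ⟨i, hi, h'⟩ := exists_realMedian_le Z G hG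
      exact ⟨i, hi, by nlinarith⟩
    · obtain ⟨i, hi, h'⟩ := exists_le_realMedian Z G hG
      exact ⟨i, hi, by nlinarith⟩
  obtain ⟨i, hi, h⟩ := key
  exact h.trans (Finset.single_le_sum (f := fun i => (Z i - c) ^ 2) (fun _ _ => sq_nonneg _) hi)

theorem norm_complexMedian_sub_sq_le {m : ℕ} (Z : Fin (2 * m + 1) → ℂ)
    (G : Finset (Fin (2 * m + 1))) (hG : m + 1 ≤ G.card) (c : ℂ) :
    ‖complexMedian Z - c‖ ^ 2 ≤ ∑ i ∈ G, ‖Z i - c‖ ^ 2 := by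
  have h (w : ℂ) : ‖w‖ ^ 2 = w.re ^ 2 + w.im ^ 2 := by
    rw [← Complex.normSq_eq_norm_sq, Complex.normSq_apply]; ring
  simp only [h, Complex.sub_re, Complex.sub_im, Finset.sum_add_distrib]
  exact add_le_add (sq_realMedian_sub_le (fun i => (Z i).re) G hG c.re)
    (sq_realMedian_sub_le (fun i => (Z i).im) G hG c.im)

/-! ### Parseval's identity on the torus -/

instance (d : ℕ) : IsProbabilityMeasure (torusMeasure d) := by
  unfold torusMeasure; infer_instance

theorem enorm_sq_eq_ofReal (w : ℂ) : ‖w‖ₑ ^ 2 = ENNReal.ofReal (‖w‖ ^ 2) := by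
  rw [ENNReal.ofReal_pow (norm_nonneg _), ofReal_norm]

theorem lintegral_enorm_sq_eq_tsum {d : ℕ} (g : C(UnitAddTorus (Fin d), ℂ)) :
    ∫⁻ x, ‖g x‖ₑ ^ 2 ∂torusMeasure d = ∑' h, ‖mFourierCoeff g h‖ₑ ^ 2 := by
  have h1 := hasSum_sq_mFourierCoeff (ContinuousMap.toLp (E := ℂ) 2 (torusMeasure d) ℂ g)
  have h2 : HasSum (fun h => ‖mFourierCoeff g h‖ ^ 2) (∫ x, ‖g x‖ ^ 2 ∂torusMeasure d) := by
    convert h1 using 1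
    · ext h
      congr 2
      exact (mFourierCoeff_toLp g h).symm
    · refine integral_congr_ae ?_
      filter_upwards [ContinuousMap.coeFn_toLp (𝕜 := ℂ) (p := 2) (torusMeasure d) g] with x hx
      exact congrArg (fun w : ℂ => ‖w‖ ^ 2) hx.symm
  have h3 : Integrable (fun x => ‖g x‖ ^ 2) (torusMeasure d) :=
    (map_continuous g).norm.pow 2 |>.integrable_of_hasCompactSupport
      (HasCompactSupport.of_compactSpace _)
  simp only [enorm_sq_eq_ofReal]
  rw [← ofReal_integral_eq_lintegral_ofReal h3 (ae_of_all _ fun _ => sq_nonneg _), ← h2.tsum_eq,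
    ENNReal.ofReal_tsum_of_nonneg (fun _ => sq_nonneg _) h2.summable]

theorem eLpNorm_two_sq_eq_tsum {d : ℕ} (g : C(UnitAddTorus (Fin d), ℂ)) :
    eLpNorm (fun x => g x) 2 (torusMeasure d) ^ 2 = ∑' h, ‖mFourierCoeff g h‖ₑ ^ 2 := by
  rw [← lintegral_enorm_sq_eq_tsum]
  have := eLpNorm_nnreal_pow_eq_lintegral (f := fun x => g x) (μ := torusMeasure d)
    (p := 2) two_ne_zero
  simpa using this

theorem mFourierCoeff_mFourier {d : ℕ} (k h : Fin d → ℤ) :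
    mFourierCoeff (mFourier k) h = if h = k then 1 else 0 := by
  have := orthonormal_iff_ite.1 (orthonormal_mFourier (d := Fin d)) h k
  rw [← this]
  simp only [mFourierLp, ContinuousMap.inner_toLp, ← mFourier_neg, mFourierCoeff, smul_eq_mul]
  simp only [mul_comm]

theorem mFourierCoeff_add {d : ℕ} (f g : C(UnitAddTorus (Fin d), ℂ)) (h : Fin d → ℤ) :
    mFourierCoeff (f + g : C(UnitAddTorus (Fin d), ℂ)) h =
      mFourierCoeff f h + mFourierCoeff g h := by
  have hi (f : C(UnitAddTorus (Fin d), ℂ)) : Integrable (fun t => mFourier (-h) t • f t)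
      (torusMeasure d) :=
    (by fun_prop : Continuous fun t => mFourier (-h) t • f t).integrable_of_hasCompactSupport
      (HasCompactSupport.of_compactSpace _)
  unfold mFourierCoeff
  simp only [ContinuousMap.add_apply, smul_add]
  exact integral_add (hi f) (hi g)

theorem mFourierCoeff_smul {d : ℕ} (c : ℂ) (f : C(UnitAddTorus (Fin d), ℂ)) (h : Fin d → ℤ) :
    mFourierCoeff (c • f : C(UnitAddTorus (Fin d), ℂ)) h = c * mFourierCoeff f h := by
  unfold mFourierCoeff
  rw [← integral_const_mul]
  refine integral_congr_ae (ae_of_all _ fun x => ?_)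
  simp only [ContinuousMap.smul_apply, smul_eq_mul]
  ring

/-- The Fourier coefficient as a linear functional on continuous functions. -/
def fourierCoeffLinear {d : ℕ} (h : Fin d → ℤ) : C(UnitAddTorus (Fin d), ℂ) →ₗ[ℂ] ℂ where
  toFun f := mFourierCoeff f h
  map_add' f g := mFourierCoeff_add f g h
  map_smul' c f := mFourierCoeff_smul c f h

theorem fourierCoeffLinear_apply {d : ℕ} (h : Fin d → ℤ) (f : C(UnitAddTorus (Fin d), ℂ)) :
    fourierCoeffLinear h f = mFourierCoeff f h := rfl

theorem mFourier_apply_add {d : ℕ} (h : Fin d → ℤ) (x y : UnitAddTorus (Fin d)) :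
    mFourier h (x + y) = mFourier h x * mFourier h y := by
  simp only [mFourier, ContinuousMap.coe_mk, Pi.add_apply, fourier_apply, smul_add,
    AddCircle.toCircle_add, Circle.coe_mul, Finset.prod_mul_distrib]

theorem mFourierCoeff_comp_add {d : ℕ} (f : C(UnitAddTorus (Fin d), ℂ))
    (a : UnitAddTorus (Fin d)) (h : Fin d → ℤ) :
    mFourierCoeff (fun x => f (a + x)) h = mFourier h a * mFourierCoeff f h := by
  have : (torusMeasure d).IsAddLeftInvariant := by unfold torusMeasure; infer_instance
  have h1 := integral_add_left_eq_self (μ := torusMeasure d)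
    (fun t => mFourier (-h) t • f t) a
  have h2 : ∀ t, mFourier (-h) t • f (a + t) = mFourier h a * (mFourier (-h) (a + t) • f (a + t)) := by
    intro t
    rw [mFourier_apply_add, smul_eq_mul, smul_eq_mul, ← mul_assoc, ← mul_assoc, ← mFourier_add,
      add_neg_cancel, mFourier_zero]
    simp
  change ∫ t, mFourier (-h) t • f (a + t) ∂torusMeasure d =
    mFourier h a * ∫ t, mFourier (-h) t • f t ∂torusMeasure d
  simp only [h2]
  rw [integral_const_mul, h1]

theorem norm_mFourier_apply {d : ℕ} (h : Fin d → ℤ) (x : UnitAddTorus (Fin d)) :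
    ‖mFourier h x‖ = 1 := by
  simp only [mFourier, ContinuousMap.coe_mk, fourier_apply, norm_prod, Circle.norm_coe,
    Finset.prod_const_one]

/-! ### Aliasing of the shifted lattice rule -/

/-- The frequency `k` contributes to the error of the lattice rule for the frequency `h`. -/
def Aliases {d : ℕ} (N : ℕ) (z : Fin d → ℕ) (h k : Fin d → ℤ) : Prop :=
  k ≠ h ∧ (N : ℤ) ∣ ∑ j, (k j - h j) * (z j : ℤ)

theorem latticePoint_eq_add {d : ℕ} (N : ℕ) (z : Fin d → ℕ) (Δ : UnitAddTorus (Fin d)) (k : ℕ) :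
    latticePoint N z Δ k = latticePoint N z 0 k + Δ := by
  ext j
  simp [latticePoint]

theorem mFourier_latticePoint_zero {d : ℕ} (N : ℕ) (z : Fin d → ℕ) (k : ℕ) (l : Fin d → ℤ) :
    mFourier l (latticePoint N z 0 k) =
      Complex.exp (2 * Real.pi * Complex.I * ((∑ j, l j * (z j : ℤ) : ℤ) / (N : ℂ))) ^ k := by
  simp only [mFourier, ContinuousMap.coe_mk, latticePoint, Pi.zero_apply, add_zero,
    fourier_coe_apply]
  rw [← Complex.exp_sum, ← Complex.exp_nat_mul]
  congr 1
  push_cast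
  simp only [Finset.sum_div, Finset.mul_sum]
  refine Finset.sum_congr rfl fun j _ => ?_
  ring

theorem mean_mFourier_latticePoint {d : ℕ} {N : ℕ} (hN : N ≠ 0) (z : Fin d → ℕ)
    (l : Fin d → ℤ) [Decidable ((N : ℤ) ∣ ∑ j, l j * (z j : ℤ))] :
    (1 / (N : ℂ)) * ∑ k ∈ Finset.range N, mFourier l (latticePoint N z 0 k) =
      if (N : ℤ) ∣ ∑ j, l j * (z j : ℤ) then 1 else 0 := by
  have hN' : (N : ℂ) ≠ 0 := by exact_mod_cast hN
  simp only [mFourier_latticePoint_zero]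
  generalize (∑ j, l j * (z j : ℤ)) = t at *
  split_ifs with hd
  · obtain ⟨c, rfl⟩ := hd
    have : Complex.exp (2 * Real.pi * Complex.I * (((N * c : ℤ) : ℂ) / (N : ℂ))) = 1 := by
      rw [Complex.exp_eq_one_iff]
      exact ⟨c, by push_cast; field_simp⟩
    simp only [this, one_pow]
    simp [hN']
  · have hne : Complex.exp (2 * Real.pi * Complex.I * ((t : ℂ) / (N : ℂ))) ≠ 1 := by
      rw [Ne, Complex.exp_eq_one_iff]
      rintro ⟨c, hc⟩
      have h1 : (t : ℂ) / N = c := by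
        have : (2 * Real.pi * Complex.I : ℂ) ≠ 0 := by
          simp [Real.pi_ne_zero]
        apply mul_left_cancel₀ this
        rw [hc]; ring
      rw [div_eq_iff hN'] at h1
      exact hd ⟨c, by rw [mul_comm]; exact_mod_cast h1⟩
    rw [geom_sum_eq hne, ← Complex.exp_nat_mul]
    have : Complex.exp (N * (2 * Real.pi * Complex.I * ((t : ℂ) / (N : ℂ)))) = 1 := by
      rw [Complex.exp_eq_one_iff]
      exact ⟨t, by field_simp⟩
    simp [this]

/-- The error of the shifted lattice rule for the frequency `h`, as a function of the shift and up
to the unimodular factor `mFourier h`. -/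
def twistedError {d : ℕ} (N : ℕ) (f : C(UnitAddTorus (Fin d), ℂ)) (z : Fin d → ℕ)
    (h : Fin d → ℤ) : C(UnitAddTorus (Fin d), ℂ) :=
  (1 / (N : ℂ)) • (∑ k ∈ Finset.range N, mFourier (-h) (latticePoint N z 0 k) •
    f.comp (ContinuousMap.addLeft (latticePoint N z 0 k))) - mFourierCoeff f h • mFourier h

theorem twistedError_apply {d : ℕ} (N : ℕ) (f : C(UnitAddTorus (Fin d), ℂ)) (z : Fin d → ℕ)
    (h : Fin d → ℤ) (Δ : UnitAddTorus (Fin d)) :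
    twistedError N f z h Δ =
      mFourier h Δ * (coeffEstimate N f (z, Δ) h - mFourierCoeff f h) := by
  have h1 : mFourier h Δ * mFourier (-h) Δ = 1 := by
    rw [← mFourier_add, add_neg_cancel, mFourier_zero]; rfl
  simp only [twistedError, coeffEstimate, ContinuousMap.sub_apply, ContinuousMap.smul_apply,
    ContinuousMap.coe_sum, Finset.sum_apply, smul_eq_mul, ContinuousMap.comp_apply,
    ContinuousMap.coe_addLeft, mul_sub]
  rw [mul_comm (mFourierCoeff f h)]
  congr 1
  rw [mul_left_comm, Finset.mul_sum (a := mFourier h Δ)]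
  congr 1
  refine Finset.sum_congr rfl fun k _ => ?_
  rw [latticePoint_eq_add N z Δ, mFourier_apply_add (-h)]
  linear_combination (-(mFourier (-h) (latticePoint N z 0 k) * f (latticePoint N z 0 k + Δ))) * h1

-- Translation multiplies the `k`-th coefficient by a character value; averaging over the lattice
-- leaves the indicator of `N ∣ (k - h)·z`, and subtracting `f̂(h)` times the character of `h`
-- removes the term `k = h`.
open scoped Classical in
theorem mFourierCoeff_twistedError {d : ℕ} {N : ℕ} (hN : N ≠ 0)
    (f : C(UnitAddTorus (Fin d), ℂ)) (z : Fin d → ℕ) (h k : Fin d → ℤ) :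
    mFourierCoeff (twistedError N f z h) k = if Aliases N z h k then mFourierCoeff f k else 0 := by
  have h1 (i : ℕ) : fourierCoeffLinear k
      (f.comp (ContinuousMap.addLeft (latticePoint N z 0 i))) =
      mFourier k (latticePoint N z 0 i) * mFourierCoeff f k :=
    mFourierCoeff_comp_add f _ k
  have h2 : (1 / (N : ℂ)) * ∑ i ∈ Finset.range N, mFourier (-h) (latticePoint N z 0 i) *
      (mFourier k (latticePoint N z 0 i) * mFourierCoeff f k) =
      (if (N : ℤ) ∣ ∑ j, (k j - h j) * (z j : ℤ) then 1 else 0) * mFourierCoeff f k := by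
    have := mean_mFourier_latticePoint hN z (k - h)
    simp only [Pi.sub_apply] at this
    rw [← this, mul_assoc, Finset.sum_mul]
    congr 1
    refine Finset.sum_congr rfl fun i _ => ?_
    rw [sub_eq_add_neg, mFourier_add]
    ring
  rw [← fourierCoeffLinear_apply, twistedError, map_sub, map_smul, map_sum, map_smul]
  simp only [map_smul, h1, smul_eq_mul]
  rw [h2, fourierCoeffLinear_apply, mFourierCoeff_mFourier]
  unfold Aliases
  by_cases hk : k = h
  · subst hk; simp
  · simp [hk]

open scoped Classical in
theorem lintegral_coeffEstimate_sub {d : ℕ} {N : ℕ} (hN : N ≠ 0)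
    (f : C(UnitAddTorus (Fin d), ℂ)) (z : Fin d → ℕ) (h : Fin d → ℤ) :
    ∫⁻ Δ, ‖coeffEstimate N f (z, Δ) h - mFourierCoeff f h‖ₑ ^ 2 ∂torusMeasure d =
      ∑' k, if Aliases N z h k then ‖mFourierCoeff f k‖ₑ ^ 2 else 0 := by
  have := lintegral_enorm_sq_eq_tsum (twistedError N f z h)
  simp only [mFourierCoeff_twistedError hN, twistedError_apply, enorm_mul] at this
  have h1 (Δ : UnitAddTorus (Fin d)) : ‖mFourier h Δ‖ₑ = 1 := by
    rw [← ofReal_norm, norm_mFourier_apply, ENNReal.ofReal_one]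
  simp only [h1, one_mul] at this
  rw [this]
  refine tsum_congr fun k => ?_
  split_ifs <;> simp

/-! ### Random generating vectors -/

/-- The generating vectors `{1, …, N-1}^d`. -/
def generators (d N : ℕ) : Finset (Fin d → ℕ) := Fintype.piFinset fun _ => Finset.Icc 1 (N - 1)

/-- The uniform distribution on the generating vectors. -/
def generatorLaw (d N : ℕ) : Measure (Fin d → ℕ) :=
  uniformOn {z : Fin d → ℕ | ∀ j, 1 ≤ z j ∧ z j ≤ N - 1}

theorem generatorLaw_eq (d N : ℕ) : generatorLaw d N = uniformOn (generators d N : Set _) := by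
  unfold generatorLaw
  congr 1
  ext z
  simp [generators, Pi.le_def, forall_and]

theorem generators_nonempty (d : ℕ) {N : ℕ} (hN : 2 ≤ N) : (generators d N).Nonempty := by
  refine ⟨fun _ => 1, ?_⟩
  simp [generators]
  omega

theorem isProbabilityMeasure_generatorLaw (d : ℕ) {N : ℕ} (hN : 2 ≤ N) :
    IsProbabilityMeasure (generatorLaw d N) := by
  rw [generatorLaw_eq]
  exact isProbabilityMeasure_uniformOn (Finset.finite_toSet _) (generators_nonempty d hN)

-- Since `l j` is invertible mod the prime `N`, the other coordinates determine `z j` mod `N`, hence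
-- in `{1, …, N-1}`. Replacing the `j`-th coordinate of a solution by an arbitrary value is
-- therefore injective on pairs.
open scoped Classical in
theorem card_filter_dvd_mul_le {d N : ℕ} (hN : N.Prime) (l : Fin d → ℤ) {j : Fin d}
    (hj : ¬ (N : ℤ) ∣ l j) :
    ((generators d N).filter fun z => (N : ℤ) ∣ ∑ i, l i * (z i : ℤ)).card * (N - 1) ≤
      (generators d N).card := by
  have hc : (Finset.Icc 1 (N - 1)).card = N - 1 := by simp
  rw [← hc, ← Finset.card_product]
  refine Finset.card_le_card_of_injOn (fun p => Function.update p.1 j p.2) ?_ ?_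
  · rintro ⟨z, a⟩ hp
    simp only [Finset.coe_product, Set.mem_prod, Finset.mem_coe, Finset.mem_filter, generators,
      Fintype.mem_piFinset] at hp ⊢
    intro i
    by_cases hi : i = j
    · subst hi; simpa using hp.2
    · simpa [hi] using hp.1.1 i
  · rintro ⟨z, a⟩ hp ⟨z', a'⟩ hp' heq
    simp only [Finset.coe_product, Set.mem_prod, Finset.mem_coe, Finset.mem_filter, generators,
      Fintype.mem_piFinset] at hp hp'
    simp only at heq
    have ha : a = a' := by simpa using congrFun heq j
    have hz (i : Fin d) (hi : i ≠ j) : z i = z' i := by simpa [hi] using congrFun heq i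
    have hd := dvd_sub hp.1.2 hp'.1.2
    rw [← Finset.sum_sub_distrib, Finset.sum_eq_single j (fun i _ hi => by rw [hz i hi, sub_self])
      (fun h => absurd (Finset.mem_univ j) h), ← mul_sub] at hd
    have hd' := ((Nat.prime_iff_prime_int.1 hN).dvd_or_dvd hd).resolve_left hj
    have h1 := Finset.mem_Icc.1 (hp.1.1 j)
    have h2 := Finset.mem_Icc.1 (hp'.1.1 j)
    have h3 : (z j : ℤ) - z' j = 0 := by
      refine Int.eq_zero_of_abs_lt_dvd hd' ?_
      rw [abs_lt]
      omega
    refine Prod.ext (funext fun i => ?_) ha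
    by_cases hi : i = j
    · subst hi; simp only; omega
    · exact hz i hi

theorem generatorLaw_dvd_le {d N : ℕ} (hN : N.Prime) (l : Fin d → ℤ) {j : Fin d}
    (hj : ¬ (N : ℤ) ∣ l j) :
    generatorLaw d N {z | (N : ℤ) ∣ ∑ i, l i * (z i : ℤ)} ≤ (((N - 1 : ℕ) : ℝ≥0∞))⁻¹ := by
  classical
  have hN2 := hN.two_le
  rw [generatorLaw_eq, ← uniformOn_inter_self (Finset.finite_toSet _)]
  have : ((generators d N : Set (Fin d → ℕ)) ∩ {z | (N : ℤ) ∣ ∑ i, l i * (z i : ℤ)}) =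
      ((generators d N).filter fun z => (N : ℤ) ∣ ∑ i, l i * (z i : ℤ) : Finset _) := by
    ext z; simp
  rw [this, uniformOn_apply_finset, Finset.inter_eq_right.2 (Finset.filter_subset _ _)]
  have h1 := card_filter_dvd_mul_le hN l hj
  have h2 : (generators d N).card ≠ 0 := (generators_nonempty d hN2).card_pos.ne'
  rw [ENNReal.div_le_iff (by exact_mod_cast h2) (by simp), mul_comm, ← div_eq_mul_inv,
    ENNReal.le_div_iff_mul_le (by left; norm_cast; omega) (by simp)]
  exact_mod_cast h1

/-! ### The frequency sets -/

theorem sum_range_rpow_neg_le {s : ℝ} (hs : 1 < s) (K : ℕ) :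
    ∑ i ∈ Finset.range K, ((i : ℝ) + 1) ^ (-s) ≤ 1 + 1 / (s - 1) := by
  have hs' : 0 < s - 1 := by linarith
  rcases K with _ | K
  · simp; positivity
  rw [Finset.sum_range_succ']
  have hanti : AntitoneOn (fun x : ℝ => x ^ (-s)) (Set.Icc 1 (1 + (K : ℕ))) := by
    intro x hx y _ hxy
    exact Real.rpow_le_rpow_of_nonpos (by linarith [hx.1]) hxy (by linarith)
  have h1 := hanti.sum_le_integral
  rw [integral_rpow (Or.inr ⟨by linarith, by
    rw [Set.uIcc_of_le (by linarith [K.cast_nonneg (α := ℝ)])]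
    simp⟩)] at h1
  have h2 : ((1 + (K : ℝ)) ^ (-s + 1) - 1 ^ (-s + 1)) / (-s + 1) ≤ 1 / (s - 1) := by
    rw [Real.one_rpow, ← neg_div_neg_eq]
    rw [show -(-s + 1) = s - 1 by ring]
    gcongr
    have : 0 ≤ (1 + (K : ℝ)) ^ (-s + 1) := by positivity
    linarith
  have h3 : ∑ i ∈ Finset.range K, (((i + 1 : ℕ) : ℝ) + 1) ^ (-s) =
      ∑ i ∈ Finset.range K, (1 + ((i + 1 : ℕ) : ℝ)) ^ (-s) :=
    Finset.sum_congr rfl fun i _ => by rw [add_comm]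
  rw [h3]
  simp only [Nat.cast_zero, zero_add, Real.one_rpow]
  linarith

theorem sum_Icc_neg_le {φ : ℤ → ℝ} {c s : ℝ} (hs : 1 < s) (hc : 0 ≤ c) (h0 : φ 0 = 1)
    (hφ : ∀ n : ℤ, n ≠ 0 → φ n ≤ c * |(n : ℝ)| ^ (-s)) (K : ℕ) :
    ∑ n ∈ Finset.Icc (-K : ℤ) K, φ n ≤ 1 + 2 * c * (1 + 1 / (s - 1)) := by
  have key : ∑ n ∈ Finset.Icc (-K : ℤ) K, φ n ≤
      1 + 2 * c * ∑ i ∈ Finset.range K, ((i : ℝ) + 1) ^ (-s) := by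
    induction K with
    | zero => simp [h0]
    | succ K ih =>
      have hI : Finset.Icc (-(K + 1 : ℕ) : ℤ) (K + 1 : ℕ) =
          insert ((K : ℤ) + 1) (insert (-(K : ℤ) - 1) (Finset.Icc (-K : ℤ) K)) := by
        ext n; simp only [Finset.mem_insert, Finset.mem_Icc]; push_cast; omega
      rw [hI, Finset.sum_insert (by simp; omega), Finset.sum_insert (by simp),
        Finset.sum_range_succ]
      have h1 := hφ ((K : ℤ) + 1) (by omega)
      have h2 := hφ (-(K : ℤ) - 1) (by omega)
      have e1 : |(((K : ℤ) + 1 : ℤ) : ℝ)| = (K : ℝ) + 1 := by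
        push_cast; exact abs_of_nonneg (by positivity)
      have e2 : |((-(K : ℤ) - 1 : ℤ) : ℝ)| = (K : ℝ) + 1 := by
        push_cast
        rw [show -(K : ℝ) - 1 = -((K : ℝ) + 1) by ring, abs_neg, abs_of_nonneg (by positivity)]
      rw [e1] at h1
      rw [e2] at h2
      linarith
  refine key.trans ?_
  gcongr
  exact sum_range_rpow_neg_le hs K

theorem one_le_r {α : ℝ} {γ : ℕ → ℝ} {d : ℕ} (h : Fin d → ℤ) : 1 ≤ r α γ h :=
  Finset.one_le_prod fun _ _ => le_max_right _ _

theorem abs_le_of_mem_freqSet {α : ℝ} (hα : 1 / 2 < α) {γ : ℕ → ℝ}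
    (hγ : ∀ j, 0 < γ j ∧ γ j ≤ 1) {d : ℕ} {L : ℝ} (hL : 0 ≤ L) {h : Fin d → ℤ}
    (hh : h ∈ freqSet α γ d L) (j : Fin d) : |(h j : ℝ)| ≤ γ j ^ (1 / (2 * α)) * L := by
  have h1 : max (|(h j : ℝ)| ^ (2 * α) / γ j) 1 ≤ r α γ h := by
    unfold r
    rw [← Finset.mul_prod_erase _ _ (Finset.mem_univ j)]
    refine le_mul_of_one_le_right (le_trans zero_le_one (le_max_right _ _)) ?_
    exact Finset.one_le_prod fun i _ => le_max_right _ _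
  have h2 : |(h j : ℝ)| ^ (2 * α) / γ j ≤ L ^ (2 * α) := (le_max_left _ _).trans (h1.trans hh)
  rw [div_le_iff₀ (hγ j).1] at h2
  have h3 : (γ j ^ (1 / (2 * α)) * L) ^ (2 * α) = L ^ (2 * α) * γ j := by
    rw [Real.mul_rpow (by have := (hγ j).1; positivity) hL, ← Real.rpow_mul (hγ j).1.le,
      one_div_mul_cancel (by linarith), Real.rpow_one, mul_comm]
  rw [← h3] at h2
  exact (Real.rpow_le_rpow_iff (abs_nonneg _) (by have := (hγ j).1; positivity) (by linarith)).1 h2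

/-- Rankin's trick: the indicator of `r(h) ≤ L^{2α}` is at most `(L^{2α} / r(h))^{s/(2α)}`, which
factorises over the coordinates. Each one-dimensional sum is bounded by a zeta sum, and `γ_j ≤ 1`
allows replacing `γ_j^{s/(2α)}` by `γ_j^{1/(2α)}`. -/
theorem ncard_freqSet_le {α : ℝ} (hα : 1 / 2 < α) {γ : ℕ → ℝ} (hγ : ∀ j, 0 < γ j ∧ γ j ≤ 1)
    (d : ℕ) {L s : ℝ} (hL : 0 ≤ L) (hs : 1 < s) :
    ((freqSet α γ d L).ncard : ℝ) ≤
      L ^ s * ∏ j : Fin d, (1 + 2 * γ j ^ (1 / (2 * α)) * (1 + 1 / (s - 1))) := by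
  have hα0 : 0 < 2 * α := by linarith
  set φ : ℕ → ℤ → ℝ := fun j n => max (|(n : ℝ)| ^ (2 * α) / γ j) 1 ^ (-(s / (2 * α))) with hφ
  have hφ0 (j : ℕ) (n : ℤ) : 0 ≤ φ j n :=
    Real.rpow_nonneg (zero_le_one.trans (le_max_right _ _)) _
  set K : ℕ := ⌈L⌉₊
  set box : Finset (Fin d → ℤ) := Fintype.piFinset fun _ => Finset.Icc (-K : ℤ) K
  have hfin := freqSet_finite hα hγ d hL
  have hsub : hfin.toFinset ⊆ box := by
    intro h hh
    rw [Set.Finite.mem_toFinset] at hh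
    simp only [box, Fintype.mem_piFinset, Finset.mem_Icc]
    intro j
    have h1 := abs_le_of_mem_freqSet hα hγ hL hh j
    have h2 : γ j ^ (1 / (2 * α)) ≤ 1 := Real.rpow_le_one (hγ j).1.le (hγ j).2 (by positivity)
    have h3 : |(h j : ℝ)| ≤ K := by
      calc _ ≤ _ := h1
        _ ≤ 1 * L := by gcongr
        _ ≤ K := by rw [one_mul]; exact Nat.le_ceil L
    rw [abs_le] at h3
    exact ⟨by exact_mod_cast h3.1, by exact_mod_cast h3.2⟩
  have hone (h : Fin d → ℤ) (hh : h ∈ freqSet α γ d L) : 1 ≤ L ^ s * ∏ j : Fin d, φ j (h j) := by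
    have hr : 0 < r α γ h := zero_lt_one.trans_le (one_le_r h)
    have h1 : 1 ≤ L ^ (2 * α) / r α γ h := (one_le_div hr).2 hh
    have h2 := Real.one_le_rpow h1 (by positivity : 0 ≤ s / (2 * α))
    rw [Real.div_rpow (by positivity) hr.le, ← Real.rpow_mul hL, mul_div_cancel₀ _ hα0.ne',
      div_eq_mul_inv, ← Real.rpow_neg hr.le] at h2
    rw [r, ← Real.finsetProd_rpow _ _ (fun i _ => zero_le_one.trans (le_max_right _ _))] at h2
    exact h2
  calc ((freqSet α γ d L).ncard : ℝ) = ∑ h ∈ hfin.toFinset, (1 : ℝ) := by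
        rw [Set.ncard_eq_toFinset_card _ hfin]; simp
    _ ≤ ∑ h ∈ hfin.toFinset, L ^ s * ∏ j : Fin d, φ j (h j) :=
        Finset.sum_le_sum fun h hh => hone h (hfin.mem_toFinset.1 hh)
    _ ≤ ∑ h ∈ box, L ^ s * ∏ j : Fin d, φ j (h j) :=
        Finset.sum_le_sum_of_subset_of_nonneg hsub fun h _ _ =>
          mul_nonneg (by positivity) (Finset.prod_nonneg fun j _ => hφ0 _ _)
    _ = L ^ s * ∏ j : Fin d, ∑ n ∈ Finset.Icc (-K : ℤ) K, φ j n := by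
        rw [← Finset.mul_sum, Finset.prod_univ_sum]
    _ ≤ _ := by
        refine mul_le_mul_of_nonneg_left (Finset.prod_le_prod
          (fun j _ => Finset.sum_nonneg fun n _ => hφ0 _ _) fun j _ => ?_) (by positivity)
        have hj := hγ j
        refine sum_Icc_neg_le hs (Real.rpow_nonneg hj.1.le _) ?_ ?_ K
        · simp [hφ, Real.zero_rpow hα0.ne']
        · intro n hn
          have hn' : 0 < |(n : ℝ)| := by positivity
          calc φ j n ≤ (|(n : ℝ)| ^ (2 * α) / γ j) ^ (-(s / (2 * α))) :=
                Real.rpow_le_rpow_of_nonpos (by have := hj.1; positivity) (le_max_left _ _)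
                  (by rw [neg_nonpos]; positivity)
            _ = γ j ^ (s / (2 * α)) * |(n : ℝ)| ^ (-s) := by
                rw [Real.div_rpow (by positivity) hj.1.le, ← Real.rpow_mul hn'.le,
                  Real.rpow_neg hj.1.le, div_inv_eq_mul, mul_comm]
                congr 2
                field_simp
            _ ≤ _ := by
                refine mul_le_mul_of_nonneg_right ?_ (by positivity)
                exact Real.rpow_le_rpow_of_exponent_ge hj.1 hj.2 (by gcongr)

theorem one_le_P {α : ℝ} {γ : ℕ → ℝ} (hγ : ∀ j, 0 < γ j ∧ γ j ≤ 1) (d N : ℕ) {τ : ℝ}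
    (hτ : 0 < τ) : 1 ≤ P α γ d N τ := by
  refine Finset.one_le_prod fun j _ => ?_
  have := Real.rpow_nonneg (hγ j).1.le (1 / (2 * α))
  have := Real.log_natCast_nonneg N
  have : 0 ≤ 2 * γ j ^ (1 / (2 * α)) * (1 + τ * Real.log N) := by positivity
  linarith

theorem Nstar_nonneg {α : ℝ} {γ : ℕ → ℝ} (hγ : ∀ j, 0 < γ j ∧ γ j ≤ 1) (d : ℕ) {N : ℕ}
    (hN : 1 ≤ N) {τ : ℝ} (hτ : 0 < τ) : 0 ≤ Nstar α γ d N τ := by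
  have := one_le_P (α := α) hγ d N hτ
  have : (1 : ℝ) ≤ N := by exact_mod_cast hN
  exact div_nonneg (by linarith) (by positivity)

theorem Nstar_mul {α : ℝ} {γ : ℕ → ℝ} (hγ : ∀ j, 0 < γ j ∧ γ j ≤ 1) (d N : ℕ)
    {τ : ℝ} (hτ : 0 < τ) : Nstar α γ d N τ * (Real.exp τ⁻¹ * P α γ d N τ) = N - 1 := by
  have := one_le_P (α := α) hγ d N hτ
  exact div_mul_cancel₀ _ (by positivity)

theorem Nstar_le {α : ℝ} {γ : ℕ → ℝ} (hγ : ∀ j, 0 < γ j ∧ γ j ≤ 1) (d : ℕ) {N : ℕ} (hN : 1 ≤ N)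
    {τ : ℝ} (hτ : 0 < τ) : Nstar α γ d N τ ≤ N - 1 := by
  rw [← Nstar_mul (α := α) hγ d N hτ]
  refine le_mul_of_one_le_right (Nstar_nonneg hγ d hN hτ) ?_
  exact one_le_mul_of_one_le_of_one_le (Real.one_le_exp (by positivity)) (one_le_P hγ d N hτ)

theorem ncard_freqSet_mul_Nstar_le {α : ℝ} (hα : 1 / 2 < α) {γ : ℕ → ℝ}
    (hγ : ∀ j, 0 < γ j ∧ γ j ≤ 1) (d : ℕ) {N : ℕ} (hN : 2 ≤ N) {τ η : ℝ} (hτ : 0 < τ)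
    (hη : 0 ≤ η) (hη1 : η ≤ 1) :
    ((freqSet α γ d (η * Nstar α γ d N τ)).ncard : ℝ) ≤ η * (N - 1) := by
  have hN1 : (1 : ℝ) < N := by exact_mod_cast hN
  have hlog : 0 < Real.log N := Real.log_pos hN1
  have hL0 := Nstar_nonneg (α := α) hγ d (by omega : 1 ≤ N) hτ
  have hLN := Nstar_le (α := α) hγ d (by omega : 1 ≤ N) hτ
  set L := Nstar α γ d N τ
  -- With this exponent `s` one has `1 + 1/(s-1) = 1 + τ log N`, so the product becomes `P`, while
  -- the excess power is at most `N^{1/(τ log N)} = exp(1/τ)`. These are the two factors in the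
  -- denominator of `Nstar`.
  have hs : 1 < 1 + 1 / (τ * Real.log N) := by simp; positivity
  have h1 := ncard_freqSet_le hα hγ d (mul_nonneg hη hL0) hs
  have h2 : ∏ j : Fin d, (1 + 2 * γ j ^ (1 / (2 * α)) *
      (1 + 1 / (1 + 1 / (τ * Real.log N) - 1))) = P α γ d N τ := by
    simp [P]
  rw [h2] at h1
  have h3 : (η * L) ^ (1 + 1 / (τ * Real.log N)) ≤ η * L * Real.exp τ⁻¹ := by
    rcases (mul_nonneg hη hL0).eq_or_lt with h0 | h0
    · rw [← h0, Real.zero_rpow (by positivity), zero_mul]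
    · rw [Real.rpow_add h0, Real.rpow_one]
      gcongr
      calc (η * L) ^ (1 / (τ * Real.log N)) ≤ (N : ℝ) ^ (1 / (τ * Real.log N)) := by
            refine Real.rpow_le_rpow h0.le ?_ (by positivity)
            nlinarith
        _ = Real.exp τ⁻¹ := by
            rw [Real.rpow_def_of_pos (by linarith)]
            congr 1
            field_simp
  calc _ ≤ _ := h1
    _ ≤ η * L * Real.exp τ⁻¹ * P α γ d N τ :=
        mul_le_mul_of_nonneg_right h3 (zero_le_one.trans (one_le_P hγ d N hτ))
    _ = η * (L * (Real.exp τ⁻¹ * P α γ d N τ)) := by ring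
    _ = _ := by rw [Nstar_mul hγ d N hτ]

/-- `P` is at least its `j`-th factor, hence at least `2 γ_j^{1/(2α)}`, so `|h_j| ≤ γ_j^{1/(2α)} N_*
≤ (N - 1)/2` on the frequency set and coordinate differences are smaller than `N`. -/
theorem eq_of_dvd_sub_of_mem_freqSet {α : ℝ} (hα : 1 / 2 < α) {γ : ℕ → ℝ}
    (hγ : ∀ j, 0 < γ j ∧ γ j ≤ 1) (d : ℕ) {N : ℕ} (hN : 2 ≤ N) {τ : ℝ} (hτ : 0 < τ)
    {h k : Fin d → ℤ} (hh : h ∈ freqSet α γ d (Nstar α γ d N τ))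
    (hk : k ∈ freqSet α γ d (Nstar α γ d N τ)) (hd : ∀ j, (N : ℤ) ∣ k j - h j) : k = h := by
  have hL0 := Nstar_nonneg (α := α) hγ d (by omega : 1 ≤ N) hτ
  funext j
  have hg : 0 ≤ γ j ^ (1 / (2 * α)) := Real.rpow_nonneg (hγ j).1.le _
  have hlog : 0 ≤ Real.log N := Real.log_natCast_nonneg N
  have hP : 2 * γ j ^ (1 / (2 * α)) ≤ P α γ d N τ := by
    unfold P
    rw [← Finset.mul_prod_erase _ _ (Finset.mem_univ j)]
    refine le_trans ?_ (le_mul_of_one_le_right (by positivity)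
      (Finset.one_le_prod fun i _ => ?_))
    · nlinarith [mul_nonneg hg (mul_nonneg hτ.le hlog)]
    · have := Real.rpow_nonneg (hγ i).1.le (1 / (2 * α))
      have : 0 ≤ 2 * γ i ^ (1 / (2 * α)) * (1 + τ * Real.log N) := by positivity
      linarith
  have h1 : 2 * (γ j ^ (1 / (2 * α)) * Nstar α γ d N τ) ≤ N - 1 := by
    rw [← Nstar_mul (α := α) hγ d N hτ]
    have he : 1 ≤ Real.exp τ⁻¹ := Real.one_le_exp (by positivity)
    have : 2 * γ j ^ (1 / (2 * α)) ≤ Real.exp τ⁻¹ * P α γ d N τ :=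
      hP.trans (le_mul_of_one_le_left (zero_le_one.trans (one_le_P hγ d N hτ)) he)
    nlinarith
  have h2 := abs_le_of_mem_freqSet hα hγ hL0 hh j
  have h3 := abs_le_of_mem_freqSet hα hγ hL0 hk j
  have h4 : |((k j - h j : ℤ) : ℝ)| < N := by
    push_cast
    calc _ ≤ |(k j : ℝ)| + |(h j : ℝ)| := abs_sub _ _
      _ < N := by linarith
  have h5 : |k j - h j| < (N : ℤ) := by exact_mod_cast h4
  have := Int.eq_zero_of_abs_lt_dvd (hd j) h5
  omega

/-! ### The error of a single randomly shifted lattice rule -/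

/-- The generating vectors for which a frequency in `A'` contributes to the error of the lattice
rule for the frequency `h`. -/
def badGenerators {d : ℕ} (N : ℕ) (A' : Finset (Fin d → ℤ)) (h : Fin d → ℤ) :
    Set (Fin d → ℕ) :=
  {z | ∃ k ∈ A', Aliases N z h k}

/-- The frequencies in `A` are pairwise incongruent modulo `N`. -/
def Incongruent {d : ℕ} (N : ℕ) (A : Finset (Fin d → ℤ)) : Prop :=
  ∀ h ∈ A, ∀ k ∈ A, (∀ j, (N : ℤ) ∣ k j - h j) → k = h

/-- Union bound over `A'`: incongruence provides, for each `k ≠ h`, a coordinate of `k - h` not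
divisible by `N`, so each `k` contributes at most `1/(N - 1)`. -/
theorem generatorLaw_badGenerators_le {d N : ℕ} (hN : N.Prime) {A A' : Finset (Fin d → ℤ)}
    (hA : Incongruent N A) (hA' : A' ⊆ A) {η : ℝ} (hη : (A'.card : ℝ) ≤ η * (N - 1))
    {h : Fin d → ℤ} (hh : h ∈ A) :
    generatorLaw d N (badGenerators N A' h) ≤ ENNReal.ofReal η := by
  classical
  have hN1 : (1 : ℝ) < N := by exact_mod_cast hN.one_lt
  have hsub : badGenerators N A' h ⊆
      ⋃ k ∈ A'.erase h, {z | (N : ℤ) ∣ ∑ j, (k j - h j) * (z j : ℤ)} := by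
    rintro z ⟨k, hk, hne, hd⟩
    simp only [Set.mem_iUnion]
    exact ⟨k, Finset.mem_erase.2 ⟨hne, hk⟩, hd⟩
  calc generatorLaw d N (badGenerators N A' h)
      ≤ ∑ k ∈ A'.erase h, generatorLaw d N {z | (N : ℤ) ∣ ∑ j, (k j - h j) * (z j : ℤ)} :=
        (measure_mono hsub).trans (measure_biUnion_finset_le _ _)
    _ ≤ ∑ k ∈ A'.erase h, ((N - 1 : ℕ) : ℝ≥0∞)⁻¹ := by
        refine Finset.sum_le_sum fun k hk => ?_
        obtain ⟨hne, hk⟩ := Finset.mem_erase.1 hk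
        have : ∃ j, ¬ (N : ℤ) ∣ k j - h j := by
          by_contra! hcon
          exact hne (hA h hh k (hA' hk) hcon)
        obtain ⟨j, hj⟩ := this
        exact generatorLaw_dvd_le hN (fun j => k j - h j) hj
    _ ≤ A'.card * ((N - 1 : ℕ) : ℝ≥0∞)⁻¹ := by
        rw [Finset.sum_const, nsmul_eq_mul]
        gcongr
        exact Finset.erase_subset _ _
    _ = ENNReal.ofReal (A'.card / ((N : ℝ) - 1)) := by
        have h1 : (N : ℝ) - 1 = ((N - 1 : ℕ) : ℝ) := by rw [Nat.cast_sub hN.one_le, Nat.cast_one]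
        rw [ENNReal.ofReal_div_of_pos (by linarith), ENNReal.ofReal_natCast, div_eq_mul_inv, h1,
          ENNReal.ofReal_natCast]
    _ ≤ ENNReal.ofReal η := by
        refine ENNReal.ofReal_le_ofReal ?_
        rwa [div_le_iff₀ (by linarith)]

/-- Here `k` is fixed and arbitrary. At most one `h ∈ A` is congruent to `k` mod `N`, contributing
at most `1`; the others contribute at most `1/(N - 1)` each, and there are at most `N - 1` of them.
-/
theorem sum_generatorLaw_aliases_le {d N : ℕ} (hN : N.Prime) {A : Finset (Fin d → ℤ)}
    (hA : Incongruent N A) (hcard : A.card ≤ N - 1) (k : Fin d → ℤ) :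
    ∑ h ∈ A, generatorLaw d N {z | Aliases N z h k} ≤ 2 := by
  classical
  have := isProbabilityMeasure_generatorLaw d hN.two_le
  have h0 : ((N - 1 : ℕ) : ℝ≥0∞) ≠ 0 := by have := hN.two_le; norm_cast; omega
  have h1 (h : Fin d → ℤ) : generatorLaw d N {z | Aliases N z h k} ≤
      (if ∀ j, (N : ℤ) ∣ k j - h j then 1 else 0) + ((N - 1 : ℕ) : ℝ≥0∞)⁻¹ := by
    split_ifs with hc
    · exact prob_le_one.trans le_self_add
    · push Not at hc
      obtain ⟨j, hj⟩ := hc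
      rw [zero_add]
      exact (measure_mono fun z hz => hz.2).trans (generatorLaw_dvd_le hN (fun j => k j - h j) hj)
  refine (Finset.sum_le_sum fun h _ => h1 h).trans ?_
  rw [Finset.sum_add_distrib, Finset.sum_boole, Finset.sum_const, nsmul_eq_mul,
    ← one_add_one_eq_two]
  refine add_le_add ?_ ?_
  · norm_cast
    rw [Finset.card_le_one]
    intro a ha b hb
    rw [Finset.mem_filter] at ha hb
    refine hA b hb.1 a ha.1 fun j => ?_
    have := dvd_sub (hb.2 j) (ha.2 j)
    rwa [sub_sub_sub_cancel_left] at this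
  · rw [← div_eq_mul_inv]
    refine ENNReal.div_le_of_le_mul ?_
    rw [one_mul]
    exact_mod_cast hcard

open scoped Classical in
theorem sum_lintegral_aliases_le {d N : ℕ} (hN : N.Prime) {A : Finset (Fin d → ℤ)}
    (hA : Incongruent N A) (hcard : A.card ≤ N - 1) (w : (Fin d → ℤ) → ℝ≥0∞) :
    ∑ h ∈ A, ∫⁻ z, ∑' k, (if Aliases N z h k then w k else 0) ∂generatorLaw d N ≤
      2 * ∑' k, w k := by
  have h1 (h : Fin d → ℤ) : ∫⁻ z, ∑' k, (if Aliases N z h k then w k else 0) ∂generatorLaw d N =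
      ∑' k, w k * generatorLaw d N {z | Aliases N z h k} := by
    rw [lintegral_tsum fun k => Measurable.of_discrete.aemeasurable]
    refine tsum_congr fun k => ?_
    rw [← lintegral_indicator_const (MeasurableSet.of_discrete)]
    rfl
  simp only [h1]
  rw [← Summable.tsum_finsetSum fun _ _ => ENNReal.summable, ← ENNReal.tsum_mul_left]
  refine ENNReal.tsum_le_tsum fun k => ?_
  rw [← Finset.mul_sum, mul_comm 2]
  gcongr
  exact sum_generatorLaw_aliases_le hN hA hcard k

theorem measurable_coeffEstimate {d : ℕ} (N : ℕ) (f : C(UnitAddTorus (Fin d), ℂ))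
    (h : Fin d → ℤ) : Measurable fun ω => coeffEstimate N f ω h := by
  refine measurable_from_prod_countable_right fun z => Continuous.measurable ?_
  unfold coeffEstimate latticePoint
  fun_prop

/-- The law of a single generating vector and shift. -/
def sampleLaw (d N : ℕ) : Measure ((Fin d → ℕ) × UnitAddTorus (Fin d)) :=
  (generatorLaw d N).prod (torusMeasure d)

theorem isProbabilityMeasure_sampleLaw (d : ℕ) {N : ℕ} (hN : 2 ≤ N) :
    IsProbabilityMeasure (sampleLaw d N) := by
  have := isProbabilityMeasure_generatorLaw d hN
  unfold sampleLaw; infer_instance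

/-- The squared error of the lattice rule for the frequency `h`. -/
def sqError {d : ℕ} (N : ℕ) (f : C(UnitAddTorus (Fin d), ℂ)) (h : Fin d → ℤ)
    (ω : (Fin d → ℕ) × UnitAddTorus (Fin d)) : ℝ≥0∞ :=
  ‖coeffEstimate N f ω h - mFourierCoeff f h‖ₑ ^ 2

theorem measurable_sqError {d : ℕ} (N : ℕ) (f : C(UnitAddTorus (Fin d), ℂ)) (h : Fin d → ℤ) :
    Measurable (sqError N f h) :=
  ((measurable_coeffEstimate N f h).sub_const _).enorm.pow_const 2

/-- The samples whose generating vector is bad. -/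
def badSamples {d : ℕ} (N : ℕ) (A' : Finset (Fin d → ℤ)) (h : Fin d → ℤ) :
    Set ((Fin d → ℕ) × UnitAddTorus (Fin d)) :=
  Prod.fst ⁻¹' badGenerators N A' h

theorem measurableSet_badSamples {d : ℕ} (N : ℕ) (A' : Finset (Fin d → ℤ)) (h : Fin d → ℤ) :
    MeasurableSet (badSamples N A' h) :=
  measurable_fst MeasurableSet.of_discrete

theorem sampleLaw_badSamples_le {d N : ℕ} (hN : N.Prime) {A A' : Finset (Fin d → ℤ)}
    (hA : Incongruent N A) (hA' : A' ⊆ A) {η : ℝ} (hη : (A'.card : ℝ) ≤ η * (N - 1))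
    {h : Fin d → ℤ} (hh : h ∈ A) :
    sampleLaw d N (badSamples N A' h) ≤ ENNReal.ofReal η := by
  have := isProbabilityMeasure_generatorLaw d hN.two_le
  have h1 : badSamples N A' h = badGenerators N A' h ×ˢ Set.univ := by
    ext; simp [badSamples]
  rw [h1, sampleLaw, Measure.prod_prod, measure_univ, mul_one]
  exact generatorLaw_badGenerators_le hN hA hA' hη hh

theorem sum_lintegral_sqError_le {d N : ℕ} (hN : N.Prime) {A : Finset (Fin d → ℤ)}
    (hA : Incongruent N A) (hcard : A.card ≤ N - 1) (f : C(UnitAddTorus (Fin d), ℂ)) :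
    ∑ h ∈ A, ∫⁻ ω, sqError N f h ω ∂sampleLaw d N ≤ 2 * ∑' k, ‖mFourierCoeff f k‖ₑ ^ 2 := by
  classical
  have := isProbabilityMeasure_generatorLaw d hN.two_le
  refine le_trans (Finset.sum_le_sum fun h _ => ?_)
    (sum_lintegral_aliases_le hN hA hcard fun k => ‖mFourierCoeff f k‖ₑ ^ 2)
  rw [sampleLaw, lintegral_prod _ (measurable_sqError N f h).aemeasurable]
  exact lintegral_mono fun z => (lintegral_coeffEstimate_sub hN.ne_zero f z h).le

-- For a good generating vector every alias of `h` lies outside `A'`, so the weights on `A'` may be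
-- set to zero before the aliasing sum is taken.
open scoped Classical in
theorem sum_lintegral_sqError_good_le {d N : ℕ} (hN : N.Prime) {A : Finset (Fin d → ℤ)}
    (hA : Incongruent N A) (hcard : A.card ≤ N - 1) (A' : Finset (Fin d → ℤ))
    (f : C(UnitAddTorus (Fin d), ℂ)) :
    ∑ h ∈ A, ∫⁻ ω, (badSamples N A' h)ᶜ.indicator (sqError N f h) ω ∂sampleLaw d N ≤
      2 * ∑' k, if k ∈ A' then 0 else ‖mFourierCoeff f k‖ₑ ^ 2 := by
  have := isProbabilityMeasure_generatorLaw d hN.two_le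
  refine le_trans (Finset.sum_le_sum fun h _ => ?_)
    (sum_lintegral_aliases_le hN hA hcard fun k => if k ∈ A' then 0 else ‖mFourierCoeff f k‖ₑ ^ 2)
  rw [sampleLaw, lintegral_prod _ ((measurable_sqError N f h).indicator
    (measurableSet_badSamples N A' h).compl).aemeasurable]
  refine lintegral_mono fun z => ?_
  by_cases hz : z ∈ badGenerators N A' h
  · have (Δ : UnitAddTorus (Fin d)) : (badSamples N A' h)ᶜ.indicator (sqError N f h) (z, Δ) = 0 :=
      Set.indicator_of_notMem (by simpa [badSamples] using hz) _
    simp [this]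
  · have (Δ : UnitAddTorus (Fin d)) : (badSamples N A' h)ᶜ.indicator (sqError N f h) (z, Δ) =
        sqError N f h (z, Δ) :=
      Set.indicator_of_mem (by simpa [badSamples] using hz) _
    simp only [this]
    refine (lintegral_coeffEstimate_sub hN.ne_zero f z h).le.trans
      (ENNReal.tsum_le_tsum fun k => ?_)
    by_cases hk : Aliases N z h k
    · have : k ∉ A' := fun hkA => hz ⟨k, hkA, hk⟩
      simp [hk, this]
    · simp [hk]

/-! ### The error of the median of independent lattice rules -/

theorem lintegral_pi_prod {ι Ω : Type*} [Fintype ι] [MeasurableSpace Ω] (μ : Measure Ω)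
    [IsProbabilityMeasure μ] (F : ι → Ω → ℝ≥0∞) (hF : ∀ i, Measurable (F i)) :
    ∫⁻ ω, ∏ i, F i (ω i) ∂Measure.pi (fun _ : ι => μ) = ∏ i, ∫⁻ x, F i x ∂μ := by
  have h1 := lintegral_prod_eq_prod_lintegral_of_indepFun Finset.univ
    (fun i (ω : ι → Ω) => F i (ω i)) (iIndepFun_pi (μ := fun _ => μ) fun i => (hF i).aemeasurable)
    fun i => (hF i).comp (measurable_pi_apply i)
  rw [h1]
  exact Finset.prod_congr rfl fun i _ =>
    (measurePreserving_eval (fun _ : ι => μ) i).lintegral_comp (hF i)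

theorem inputLaw_eq (d N m : ℕ) : inputLaw d N m = Measure.pi fun _ => sampleLaw d N := rfl

/-- Dropping `i` from `S` makes all factors depend on different samples, hence independent. At least
`m` indicators remain; when `i ∉ S` there are `m + 1`, and `p ≤ 1` disposes of the extra one. -/
theorem lintegral_mul_prod_indicator_le {ι Ω : Type*} [Fintype ι] [DecidableEq ι]
    [MeasurableSpace Ω] (μ : Measure Ω) [IsProbabilityMeasure μ] {g : Ω → ℝ≥0∞} (hg : Measurable g) {b : Set Ω}
    (hb : MeasurableSet b) {p : ℝ≥0∞} (hp : μ b ≤ p) (hp1 : p ≤ 1) {m : ℕ} {S : Finset ι}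
    (hS : S.card = m + 1) (i : ι) :
    ∫⁻ ω, g (ω i) * ∏ j ∈ S.erase i, b.indicator 1 (ω j) ∂Measure.pi (fun _ : ι => μ) ≤
      (∫⁻ x, g x ∂μ) * p ^ m := by
  set F : ι → Ω → ℝ≥0∞ := fun j x =>
    if j = i then g x else if j ∈ S then b.indicator 1 x else 1
  have hF (j : ι) : Measurable (F j) := by
    simp only [F]
    split_ifs
    · exact hg
    · exact measurable_one.indicator hb
    · exact measurable_const
  have hsplit (G : ι → ℝ≥0∞) (c : ℝ≥0∞) (B : ι → ℝ≥0∞)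
      (hG : ∀ j, G j = if j = i then c else if j ∈ S then B j else 1) :
      ∏ j, G j = c * ∏ j ∈ S.erase i, B j := by
    rw [← Finset.mul_prod_erase _ _ (Finset.mem_univ i), hG i, if_pos rfl]
    congr 1
    rw [← Finset.prod_subset (Finset.erase_subset_erase i (Finset.subset_univ S))]
    · refine Finset.prod_congr rfl fun j hj => ?_
      rw [Finset.mem_erase] at hj
      rw [hG, if_neg hj.1, if_pos hj.2]
    · intro j hj hj'
      have h1 := (Finset.mem_erase.1 hj).1
      rw [hG, if_neg h1, if_neg fun h => hj' (Finset.mem_erase.2 ⟨h1, h⟩)]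
  have h1 (ω : ι → Ω) : g (ω i) * ∏ j ∈ S.erase i, b.indicator 1 (ω j) = ∏ j, F j (ω j) := by
    refine (hsplit (fun j => F j (ω j)) (g (ω i)) (fun j => b.indicator 1 (ω j)) fun j => ?_).symm
    by_cases hj : j = i
    · subst hj; simp [F]
    · simp [F, hj]
  simp only [h1]
  rw [lintegral_pi_prod μ F hF, hsplit (fun j => ∫⁻ x, F j x ∂μ) (∫⁻ x, g x ∂μ) (fun _ => μ b)]
  · gcongr
    rw [Finset.prod_const]
    calc μ b ^ (S.erase i).card ≤ p ^ (S.erase i).card := by gcongr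
      _ ≤ p ^ m := by
        refine pow_le_pow_right_of_le_one' hp1 ?_
        have := Finset.pred_card_le_card_erase (a := i) (s := S)
        omega
  · intro j
    simp only [F]
    split_ifs
    · rfl
    · rw [lintegral_indicator_one hb]
    · simp

/-- An upper bound for the squared error of the median as an estimate of `c`: the squared errors of
the samples outside of `b`, and the squared errors of all samples if more than half of them lie
in `b`. -/
def medianBound {Ω : Type*} (m : ℕ) (Y : Ω → ℂ) (b : Set Ω) (c : ℂ)
    (ω : Fin (2 * m + 1) → Ω) : ℝ≥0∞ :=
  ∑ i, bᶜ.indicator (fun x => ‖Y x - c‖ₑ ^ 2) (ω i) +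
    ∑ i, ∑ S ∈ Finset.powersetCard (m + 1) Finset.univ,
      ‖Y (ω i) - c‖ₑ ^ 2 * ∏ j ∈ S.erase i, b.indicator 1 (ω j)

/-- Either the samples outside `b` form a majority and bound the median alone, or some `S` consists
of `m + 1` samples in `b`. In the second case the product over that `S` equals `1`, so the term of
`S` already gives the full squared error of each sample. -/
theorem enorm_complexMedian_sub_sq_le {Ω : Type*} {m : ℕ} (Y : Ω → ℂ) (b : Set Ω) (c : ℂ)
    (ω : Fin (2 * m + 1) → Ω) :
    ‖complexMedian (fun i => Y (ω i)) - c‖ₑ ^ 2 ≤ medianBound m Y b c ω := by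
  classical
  have key (G : Finset (Fin (2 * m + 1))) (hG : m + 1 ≤ G.card) :
      ‖complexMedian (fun i => Y (ω i)) - c‖ₑ ^ 2 ≤ ∑ i ∈ G, ‖Y (ω i) - c‖ₑ ^ 2 := by
    simp only [enorm_sq_eq_ofReal]
    rw [← ENNReal.ofReal_sum_of_nonneg fun _ _ => sq_nonneg _]
    exact ENNReal.ofReal_le_ofReal (norm_complexMedian_sub_sq_le (fun i => Y (ω i)) G hG c)
  set B : Finset (Fin (2 * m + 1)) := Finset.univ.filter fun i => ω i ∈ b with hBdef
  by_cases hG : m + 1 ≤ Bᶜ.card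
  · refine (key Bᶜ hG).trans (le_trans ?_ le_self_add)
    refine (Finset.sum_le_sum fun i hi => ?_).trans
      (Finset.sum_le_sum_of_subset (Finset.subset_univ Bᶜ))
    have hi' : ω i ∉ b := by simpa [hBdef] using hi
    simp [hi']
  · have hB : m + 1 ≤ B.card := by
      rw [Finset.card_compl, Fintype.card_fin] at hG
      omega
    obtain ⟨S, hS, hcard⟩ := Finset.exists_subset_card_eq hB
    refine (key Finset.univ (by simp; omega)).trans (le_trans ?_ le_add_self)
    refine Finset.sum_le_sum fun i _ => ?_
    refine le_trans ?_ (Finset.single_le_sum (f := fun S : Finset (Fin (2 * m + 1)) =>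
      ‖Y (ω i) - c‖ₑ ^ 2 * ∏ j ∈ S.erase i, b.indicator 1 (ω j)) (fun _ _ => zero_le)
      (Finset.mem_powersetCard.2 ⟨Finset.subset_univ S, hcard⟩))
    rw [Finset.prod_eq_one, mul_one]
    intro j hj
    have := (Finset.mem_filter.1 (hS (Finset.mem_of_mem_erase hj))).2
    simp [this]

theorem measurable_indicator_enorm_sq {Ω : Type*} [MeasurableSpace Ω] {Y : Ω → ℂ}
    (hY : Measurable Y) {b : Set Ω} (hb : MeasurableSet b) (c : ℂ) :
    Measurable (bᶜ.indicator fun x => ‖Y x - c‖ₑ ^ 2) :=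
  ((hY.sub_const _).enorm.pow_const 2).indicator hb.compl

theorem measurable_mul_prod_indicator {ι Ω : Type*} [DecidableEq ι] [MeasurableSpace Ω]
    {Y : Ω → ℂ} (hY : Measurable Y) {b : Set Ω} (hb : MeasurableSet b) (c : ℂ) (i : ι)
    (S : Finset ι) : Measurable fun ω : ι → Ω =>
      ‖Y (ω i) - c‖ₑ ^ 2 * ∏ j ∈ S.erase i, (b.indicator 1 (ω j) : ℝ≥0∞) :=
  (((hY.sub_const _).enorm.pow_const 2).comp (measurable_pi_apply i)).mul
    (Finset.measurable_fun_prod _ fun j _ =>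
      (measurable_one.indicator hb).comp (measurable_pi_apply j))

theorem measurable_medianBound {Ω : Type*} [MeasurableSpace Ω] (m : ℕ) {Y : Ω → ℂ}
    (hY : Measurable Y) {b : Set Ω} (hb : MeasurableSet b) (c : ℂ) :
    Measurable (medianBound m Y b c) :=
  (Finset.measurable_fun_sum _ fun i _ =>
    (measurable_indicator_enorm_sq hY hb c).comp (measurable_pi_apply i)).add
  (Finset.measurable_fun_sum _ fun i _ => Finset.measurable_fun_sum _ fun S _ =>
    measurable_mul_prod_indicator hY hb c i S)

theorem lintegral_medianBound_le {Ω : Type*} [MeasurableSpace Ω] (μ : Measure Ω)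
    [IsProbabilityMeasure μ] (m : ℕ) {Y : Ω → ℂ} (hY : Measurable Y) {b : Set Ω}
    (hb : MeasurableSet b) {p : ℝ≥0∞} (hp : μ b ≤ p) (hp1 : p ≤ 1) (c : ℂ) :
    ∫⁻ ω, medianBound m Y b c ω ∂Measure.pi (fun _ => μ) ≤
      (2 * m + 1 : ℕ) * ∫⁻ x, bᶜ.indicator (fun x => ‖Y x - c‖ₑ ^ 2) x ∂μ +
        (2 * m + 1 : ℕ) * (2 ^ (2 * m + 1) * p ^ m) * ∫⁻ x, ‖Y x - c‖ₑ ^ 2 ∂μ := by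
  have hg : Measurable fun x => ‖Y x - c‖ₑ ^ 2 := (hY.sub_const _).enorm.pow_const 2
  have hgood := measurable_indicator_enorm_sq hY hb c
  have hterm := measurable_mul_prod_indicator (ι := Fin (2 * m + 1)) hY hb c
  have hgi (i : Fin (2 * m + 1)) : Measurable fun ω : Fin (2 * m + 1) → Ω =>
      bᶜ.indicator (fun x => ‖Y x - c‖ₑ ^ 2) (ω i) :=
    hgood.comp (measurable_pi_apply i)
  unfold medianBound
  rw [lintegral_add_left (Finset.measurable_fun_sum _ fun i _ => hgi i),
    lintegral_finsetSum _ fun i _ => hgi i,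
    lintegral_finsetSum _ fun i _ => Finset.measurable_fun_sum _ fun S _ => hterm i S]
  refine add_le_add ?_ ?_
  · refine le_of_eq ?_
    rw [Finset.sum_congr rfl fun i _ =>
      (measurePreserving_eval (fun _ : Fin (2 * m + 1) => μ) i).lintegral_comp hgood]
    simp
  · have h1 (i : Fin (2 * m + 1)) : ∫⁻ ω, ∑ S ∈ Finset.powersetCard (m + 1) Finset.univ,
        ‖Y (ω i) - c‖ₑ ^ 2 * ∏ j ∈ S.erase i, b.indicator 1 (ω j)
          ∂Measure.pi (fun _ : Fin (2 * m + 1) => μ) ≤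
        2 ^ (2 * m + 1) * p ^ m * ∫⁻ x, ‖Y x - c‖ₑ ^ 2 ∂μ := by
      rw [lintegral_finsetSum _ fun S _ => hterm i S]
      refine (Finset.sum_le_sum fun S hS => lintegral_mul_prod_indicator_le μ hg hb hp hp1
        (Finset.mem_powersetCard.1 hS).2 i).trans ?_
      rw [Finset.sum_const, nsmul_eq_mul, Finset.card_powersetCard, Finset.card_univ,
        Fintype.card_fin, mul_assoc, mul_comm (p ^ m)]
      gcongr
      exact_mod_cast Nat.choose_le_two_pow _ _
    refine (Finset.sum_le_sum fun i _ => h1 i).trans ?_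
    rw [Finset.sum_const, Finset.card_univ, Fintype.card_fin, nsmul_eq_mul, mul_assoc, mul_assoc,
      mul_assoc]

/-! ### The randomized error of the algorithm -/

theorem tsum_enorm_sq_mul_r_le_one {α : ℝ} {γ : ℕ → ℝ} {d : ℕ} {f : C(UnitAddTorus (Fin d), ℂ)}
    (hf : f ∈ korobovBall α γ d) :
    ∑' k, ‖mFourierCoeff f k‖ₑ ^ 2 * ENNReal.ofReal (r α γ k) ≤ 1 := by
  have hr (k : Fin d → ℤ) : 0 ≤ r α γ k := zero_le_one.trans (one_le_r k)
  simp only [enorm_sq_eq_ofReal, ← ENNReal.ofReal_mul (sq_nonneg _)]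
  rw [← ENNReal.ofReal_tsum_of_nonneg (fun k => mul_nonneg (sq_nonneg _) (hr k)) hf.1,
    ← ENNReal.ofReal_one]
  refine ENNReal.ofReal_le_ofReal ?_
  have h1 := hf.2
  rw [korobovNorm, Real.sqrt_le_one] at h1
  exact h1

theorem tsum_enorm_sq_le_one {α : ℝ} {γ : ℕ → ℝ} {d : ℕ} {f : C(UnitAddTorus (Fin d), ℂ)}
    (hf : f ∈ korobovBall α γ d) : ∑' k, ‖mFourierCoeff f k‖ₑ ^ 2 ≤ 1 := by
  refine (ENNReal.tsum_le_tsum fun k => ?_).trans (tsum_enorm_sq_mul_r_le_one hf)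
  exact le_mul_of_one_le_right zero_le (ENNReal.one_le_ofReal.2 (one_le_r k))

open scoped Classical in
theorem tsum_enorm_sq_notMem_le {α : ℝ} {γ : ℕ → ℝ} {d : ℕ}
    {f : C(UnitAddTorus (Fin d), ℂ)} (hf : f ∈ korobovBall α γ d) {L : ℝ} (hL : 0 < L)
    {A : Finset (Fin d → ℤ)} (hA : ∀ k, k ∉ A → k ∉ freqSet α γ d L) :
    ∑' k, (if k ∈ A then 0 else ‖mFourierCoeff f k‖ₑ ^ 2) ≤ ENNReal.ofReal (L ^ (-(2 * α))) := by
  have hLpos : 0 < L ^ (2 * α) := Real.rpow_pos_of_pos hL _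
  calc ∑' k, (if k ∈ A then 0 else ‖mFourierCoeff f k‖ₑ ^ 2)
      ≤ ∑' k, ENNReal.ofReal (L ^ (-(2 * α))) *
          (‖mFourierCoeff f k‖ₑ ^ 2 * ENNReal.ofReal (r α γ k)) := by
        refine ENNReal.tsum_le_tsum fun k => ?_
        split_ifs with hk
        · exact zero_le
        · have h1 : L ^ (2 * α) < r α γ k := not_le.1 (hA k hk)
          rw [mul_left_comm, ← ENNReal.ofReal_mul (by positivity)]
          refine le_mul_of_one_le_right zero_le (ENNReal.one_le_ofReal.2 ?_)
          rw [Real.rpow_neg hL.le, inv_mul_eq_div, one_le_div hLpos]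
          exact h1.le
    _ ≤ _ := by
        rw [ENNReal.tsum_mul_left]
        exact mul_le_of_le_one_right zero_le (tsum_enorm_sq_mul_r_le_one hf)

open scoped Classical in
theorem eLpNorm_sub_medianApprox_sq {α : ℝ} {γ : ℕ → ℝ} {d N m : ℕ} {τ : ℝ}
    (hfin : (freqSet α γ d (Nstar α γ d N τ)).Finite)
    (ω : Fin (2 * m + 1) → (Fin d → ℕ) × UnitAddTorus (Fin d))
    (f : C(UnitAddTorus (Fin d), ℂ)) :
    eLpNorm (fun x => f x - medianApprox α γ N m τ ω f x) 2 (torusMeasure d) ^ 2 =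
      ∑' k, (if k ∈ hfin.toFinset then 0 else ‖mFourierCoeff f k‖ₑ ^ 2) +
        ∑ h ∈ hfin.toFinset,
          ‖complexMedian (fun i => coeffEstimate N f (ω i) h) - mFourierCoeff f h‖ₑ ^ 2 := by
  set A := hfin.toFinset
  set c : (Fin d → ℤ) → ℂ := fun h => complexMedian (fun i => coeffEstimate N f (ω i) h)
  have h1 : (fun x => f x - medianApprox α γ N m τ ω f x) =
      fun x => (f - ∑ h ∈ A, c h • mFourier h : C(UnitAddTorus (Fin d), ℂ)) x := by
    ext x
    rw [medianApprox, finsum_mem_eq_finite_toFinset_sum _ hfin]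
    simp [A, c]
  have h2 (k : Fin d → ℤ) :
      mFourierCoeff (f - ∑ h ∈ A, c h • mFourier h : C(UnitAddTorus (Fin d), ℂ)) k =
        mFourierCoeff f k - if k ∈ A then c k else 0 := by
    rw [← fourierCoeffLinear_apply, map_sub, map_sum]
    simp only [map_smul, fourierCoeffLinear_apply, mFourierCoeff_mFourier, smul_eq_mul, mul_ite,
      mul_one, mul_zero, Finset.sum_ite_eq]
  rw [h1, eLpNorm_two_sq_eq_tsum]
  simp only [h2]
  have h3 (k : Fin d → ℤ) : ‖mFourierCoeff f k - if k ∈ A then c k else 0‖ₑ ^ 2 =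
      (if k ∈ A then 0 else ‖mFourierCoeff f k‖ₑ ^ 2) +
        if k ∈ A then ‖c k - mFourierCoeff f k‖ₑ ^ 2 else 0 := by
    split_ifs
    · rw [zero_add, ← enorm_neg, neg_sub]
    · rw [sub_zero, add_zero]
  simp only [h3]
  rw [ENNReal.tsum_add, tsum_eq_sum (s := A) fun k hk => if_neg hk]
  congr 1
  exact Finset.sum_congr rfl fun k hk => if_pos hk

/-- The three terms are truncation outside `A`, aliasing from outside the core `A'` in good samples,
and the event of a bad majority. Shrinking `η` enlarges the second and makes the third decay faster
in `m`. -/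
theorem lintegral_eLpNorm_sub_medianApprox_le {α : ℝ} (hα : 1 / 2 < α) {γ : ℕ → ℝ}
    (hγ : ∀ j, 0 < γ j ∧ γ j ≤ 1) {d N m : ℕ} (hN : N.Prime) {τ η : ℝ} (hτ : 0 < τ) (hη : 0 < η)
    (hη1 : η ≤ 1) {f : C(UnitAddTorus (Fin d), ℂ)} (hf : f ∈ korobovBall α γ d) :
    ∫⁻ ω, eLpNorm (fun x => f x - medianApprox α γ N m τ ω f x) 2 (torusMeasure d) ^ 2
        ∂inputLaw d N m ≤
      ENNReal.ofReal (Nstar α γ d N τ ^ (-(2 * α)) +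
        ((2 * m + 1 : ℕ) * (2 * (η * Nstar α γ d N τ) ^ (-(2 * α))) +
          (2 * m + 1 : ℕ) * (2 ^ (2 * m + 1) * η ^ m) * 2)) := by
  classical
  have hN1 : (1 : ℝ) < N := by exact_mod_cast hN.one_lt
  have hL0 : 0 < Nstar α γ d N τ := by
    have := one_le_P (α := α) hγ d N hτ
    exact div_pos (by linarith) (by positivity)
  have hcard1 := ncard_freqSet_mul_Nstar_le hα hγ d hN.two_le hτ zero_le_one le_rfl
  have hcardη := ncard_freqSet_mul_Nstar_le hα hγ d hN.two_le hτ hη.le hη1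
  rw [one_mul, one_mul] at hcard1
  have hfin := freqSet_finite hα hγ d hL0.le
  have hfin' := freqSet_finite hα hγ d (mul_pos hη hL0).le
  rw [Set.ncard_eq_toFinset_card _ hfin] at hcard1
  rw [Set.ncard_eq_toFinset_card _ hfin'] at hcardη
  have hsub : hfin'.toFinset ⊆ hfin.toFinset := by
    rw [Set.Finite.toFinset_subset_toFinset]
    intro h hh
    refine le_trans (b := (η * Nstar α γ d N τ) ^ (2 * α)) hh ?_
    exact Real.rpow_le_rpow (by positivity) (mul_le_of_le_one_left hL0.le hη1) (by linarith)
  have hA : Incongruent N hfin.toFinset := fun h hh k hk hd =>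
    eq_of_dvd_sub_of_mem_freqSet hα hγ d hN.two_le hτ (hfin.mem_toFinset.1 hh)
      (hfin.mem_toFinset.1 hk) hd
  have hcard : hfin.toFinset.card ≤ N - 1 := by
    have : (hfin.toFinset.card : ℝ) ≤ ((N - 1 : ℕ) : ℝ) := by
      rw [Nat.cast_sub hN.one_le, Nat.cast_one]; exact hcard1
    exact_mod_cast this
  have hprob := isProbabilityMeasure_sampleLaw d hN.two_le
  have hprob' : IsProbabilityMeasure (inputLaw d N m) := by rw [inputLaw_eq]; infer_instance
  set A := hfin.toFinset
  set A' := hfin'.toFinset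
  have hmeas (h : Fin d → ℤ) : Measurable (medianBound m (fun x => coeffEstimate N f x h)
      (badSamples N A' h) (mFourierCoeff f h)) :=
    measurable_medianBound m (measurable_coeffEstimate N f h) (measurableSet_badSamples N A' h) _
  have hpt (ω : Fin (2 * m + 1) → (Fin d → ℕ) × UnitAddTorus (Fin d)) :
      eLpNorm (fun x => f x - medianApprox α γ N m τ ω f x) 2 (torusMeasure d) ^ 2 ≤
        ENNReal.ofReal (Nstar α γ d N τ ^ (-(2 * α))) + ∑ h ∈ A,
          medianBound m (fun x => coeffEstimate N f x h) (badSamples N A' h)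
            (mFourierCoeff f h) ω := by
    rw [eLpNorm_sub_medianApprox_sq hfin]
    refine add_le_add (tsum_enorm_sq_notMem_le hf hL0 fun k hk => ?_)
      (Finset.sum_le_sum fun h _ => enorm_complexMedian_sub_sq_le _ _ _ _)
    rwa [Set.Finite.mem_toFinset] at hk
  have hR : ((2 * m + 1 : ℕ) : ℝ≥0∞) = ENNReal.ofReal (2 * m + 1 : ℕ) :=
    (ENNReal.ofReal_natCast _).symm
  have h2 : (2 : ℝ≥0∞) = ENNReal.ofReal 2 := by simp
  calc _ ≤ _ := lintegral_mono hpt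
    _ = ENNReal.ofReal (Nstar α γ d N τ ^ (-(2 * α))) + ∑ h ∈ A, ∫⁻ ω,
          medianBound m (fun x => coeffEstimate N f x h) (badSamples N A' h)
            (mFourierCoeff f h) ω ∂inputLaw d N m := by
        rw [lintegral_add_left measurable_const, lintegral_finsetSum _ fun h _ => hmeas h]
        simp
    _ ≤ ENNReal.ofReal (Nstar α γ d N τ ^ (-(2 * α))) + ∑ h ∈ A, ((2 * m + 1 : ℕ) *
          ∫⁻ x, (badSamples N A' h)ᶜ.indicator (sqError N f h) x ∂sampleLaw d N +
          (2 * m + 1 : ℕ) * (2 ^ (2 * m + 1) * ENNReal.ofReal η ^ m) *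
            ∫⁻ x, sqError N f h x ∂sampleLaw d N) := by
        gcongr with h hh
        exact lintegral_medianBound_le (sampleLaw d N) m (measurable_coeffEstimate N f h)
          (measurableSet_badSamples N A' h) (sampleLaw_badSamples_le hN hA hsub hcardη hh)
          (by simpa using hη1) _
    _ ≤ ENNReal.ofReal (Nstar α γ d N τ ^ (-(2 * α))) + ((2 * m + 1 : ℕ) *
          (2 * ENNReal.ofReal ((η * Nstar α γ d N τ) ^ (-(2 * α)))) +
          (2 * m + 1 : ℕ) * (2 ^ (2 * m + 1) * ENNReal.ofReal η ^ m) * (2 * 1)) := by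
        rw [Finset.sum_add_distrib, ← Finset.mul_sum, ← Finset.mul_sum]
        gcongr
        · refine (sum_lintegral_sqError_good_le hN hA hcard A' f).trans ?_
          gcongr
          refine tsum_enorm_sq_notMem_le hf (mul_pos hη hL0) fun k hk => ?_
          rwa [Set.Finite.mem_toFinset] at hk
        · refine (sum_lintegral_sqError_le hN hA hcard f).trans ?_
          gcongr
          exact tsum_enorm_sq_le_one hf
    _ = _ := by
        rw [hR, h2, mul_one, ← ENNReal.ofReal_pow hη.le, ← ENNReal.ofReal_pow zero_le_two,
          ← ENNReal.ofReal_mul (by positivity), ← ENNReal.ofReal_mul (by positivity),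
          ← ENNReal.ofReal_mul (by positivity), ← ENNReal.ofReal_mul (by positivity),
          ← ENNReal.ofReal_mul (by positivity), ← ENNReal.ofReal_add (by positivity) (by positivity),
          ← ENNReal.ofReal_add (by positivity) (by positivity)]

theorem randomizedError_le {α : ℝ} (hα : 1 / 2 < α) {γ : ℕ → ℝ}
    (hγ : ∀ j, 0 < γ j ∧ γ j ≤ 1) {d N m : ℕ} (hN : N.Prime) {τ η : ℝ} (hτ : 0 < τ) (hη : 0 < η)
    (hη1 : η ≤ 1) {E : ℝ} (hE0 : 0 ≤ E) (hE : Nstar α γ d N τ ^ (-(2 * α)) +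
        ((2 * m + 1 : ℕ) * (2 * (η * Nstar α γ d N τ) ^ (-(2 * α))) +
          (2 * m + 1 : ℕ) * (2 ^ (2 * m + 1) * η ^ m) * 2) ≤ E ^ 2) :
    randomizedError α γ d N m τ ≤ ENNReal.ofReal E := by
  refine iSup₂_le fun f hf => ?_
  have h1 := (lintegral_eLpNorm_sub_medianApprox_le hα hγ (m := m) hN hτ hη hη1 hf).trans
    (ENNReal.ofReal_le_ofReal hE)
  refine (ENNReal.rpow_le_rpow h1 (by norm_num : (0 : ℝ) ≤ 1 / 2)).trans (le_of_eq ?_)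
  rw [ENNReal.ofReal_rpow_of_nonneg (by positivity) (by norm_num), ← Real.sqrt_eq_rpow,
    Real.sqrt_sq hE0]

/-! ### The number of repetitions -/

theorem log_inv_pos {δ : ℝ} (hδ₀ : 0 < δ) (hδ₁ : δ < 1) : 0 < Real.log δ⁻¹ :=
  Real.log_pos ((one_lt_inv₀ hδ₀).2 hδ₁)

theorem one_le_four_mul_exp_one : 1 ≤ 4 * Real.exp 1 := by
  linarith [Real.add_one_le_exp (1 : ℝ)]

theorem repCentre_nonneg {δ : ℝ} (hδ₀ : 0 < δ) (hδ₁ : δ < 1) {N : ℕ} (hN : 1 ≤ N) :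
    0 ≤ repCentre δ N := by
  have h1 : (1 : ℝ) ≤ N := by exact_mod_cast hN
  have h2 : 0 ≤ ((N : ℝ) - 1) / (4 * Real.exp 1) := div_nonneg (by linarith) (by positivity)
  have h3 := Real.log_nonneg (by linarith : 1 ≤ 1 + ((N : ℝ) - 1) / (4 * Real.exp 1))
  have h4 := log_inv_pos hδ₀ hδ₁
  unfold repCentre
  linarith

theorem repCentre_le (δ : ℝ) {N : ℕ} (hN : 1 ≤ N) :
    repCentre δ N ≤ 2 * Real.log N + 2 * Real.log δ⁻¹ := by
  have h1 : (1 : ℝ) ≤ N := by exact_mod_cast hN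
  have h2 : 0 ≤ ((N : ℝ) - 1) / (4 * Real.exp 1) := div_nonneg (by linarith) (by positivity)
  have h3 : ((N : ℝ) - 1) / (4 * Real.exp 1) ≤ N - 1 :=
    div_le_self (by linarith) one_le_four_mul_exp_one
  unfold repCentre
  gcongr
  linarith

/-- The lower bound on the repetitions matters only through `m ≥ log N - O(1)`, which makes
`e^{-2αm}` of order `N^{-2α}`; the term in `δ` has the favourable sign and is dropped. -/
theorem log_le_of_repCentre_le {δ : ℝ} (hδ₀ : 0 < δ) (hδ₁ : δ < 1) {N m : ℕ} (hN : 1 ≤ N)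
    (hm : repCentre δ N - 1 ≤ ((2 * m + 1 : ℕ) : ℝ)) :
    Real.log N ≤ m + (Real.log (4 * Real.exp 1) + 1) := by
  have h1 : (1 : ℝ) ≤ N := by exact_mod_cast hN
  have h2 : Real.log N - Real.log (4 * Real.exp 1) ≤
      Real.log (1 + ((N : ℝ) - 1) / (4 * Real.exp 1)) := by
    rw [← Real.log_div (by positivity) (by positivity)]
    refine Real.log_le_log (by positivity) ?_
    rw [← sub_le_iff_le_add, ← sub_div, sub_sub_cancel, div_le_one (by positivity)]
    exact one_le_four_mul_exp_one
  have h3 := log_inv_pos hδ₀ hδ₁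
  unfold repCentre at hm
  push_cast at hm
  linarith

theorem repCentre_add_one_le_rpow {δ : ℝ} (hδ₀ : 0 < δ) (hδ₁ : δ < 1) {κ : ℝ} (hκ : 0 < κ)
    {N : ℕ} (hN : 1 ≤ N) :
    repCentre δ N + 1 ≤ (2 / κ + 2 * Real.log δ⁻¹ + 1) * (N : ℝ) ^ κ := by
  have h1 : (1 : ℝ) ≤ N := by exact_mod_cast hN
  have h2 := repCentre_le δ hN
  have h3 := Real.log_le_rpow_div (by linarith : (0 : ℝ) ≤ N) hκ
  have h4 := Real.one_le_rpow h1 hκ.le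
  have h5 := log_inv_pos hδ₀ hδ₁
  calc repCentre δ N + 1 ≤ 2 * ((N : ℝ) ^ κ / κ) + (2 * Real.log δ⁻¹ + 1) * 1 := by linarith
    _ ≤ 2 * ((N : ℝ) ^ κ / κ) + (2 * Real.log δ⁻¹ + 1) * (N : ℝ) ^ κ := by gcongr
    _ = _ := by ring

/-! ### Admissible parameters -/

theorem Admissible.mul_exp_le {α : ℝ} {γ : ℕ → ℝ} (hγ : ∀ j, 0 < γ j ∧ γ j ≤ 1) {d N : ℕ} {τ : ℝ}
    (h : Admissible α γ d N τ) : P α γ d N τ * Real.exp (4 * τ⁻¹) ≤ N - 1 := by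
  obtain ⟨hτ, h⟩ := h
  have hP := one_le_P (α := α) hγ d N hτ
  have h1 : 4 * τ⁻¹ ≤ (4 * τ⁻¹ + 4) / Real.exp (-1) := by
    rw [le_div_iff₀ (Real.exp_pos _)]
    have : Real.exp (-1) ≤ 1 := Real.exp_le_one_iff.2 (by norm_num)
    have : 0 < τ⁻¹ := inv_pos.2 hτ
    nlinarith
  have h2 : P α γ d N τ * Real.exp (4 * τ⁻¹) ≤
      P α γ d N τ * Real.exp ((4 * τ⁻¹ + 4) / Real.exp (-1)) := by
    gcongr
  linarith

theorem Admissible.one_le_Nstar {α : ℝ} {γ : ℕ → ℝ} (hγ : ∀ j, 0 < γ j ∧ γ j ≤ 1) {d N : ℕ}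
    {τ : ℝ} (h : Admissible α γ d N τ) : 1 ≤ Nstar α γ d N τ := by
  have hP := one_le_P (α := α) hγ d N h.1
  rw [Nstar, one_le_div (by positivity)]
  refine le_trans ?_ (h.mul_exp_le hγ)
  rw [mul_comm]
  have : 0 < τ⁻¹ := inv_pos.2 h.1
  gcongr
  linarith

/-- Compactness: `exp(4/τ) ≤ N` keeps `τ` away from `0`, and the factor of `P` for the first
variable, available as `d ≥ 1`, keeps it bounded. On the resulting interval everything is
continuous. -/
theorem exists_maximal_Nstar {α : ℝ} {γ : ℕ → ℝ} (hγ : ∀ j, 0 < γ j ∧ γ j ≤ 1) {d N : ℕ}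
    (hd : 1 ≤ d) (hN : 2 ≤ N) {τ₀ : ℝ} (h₀ : Admissible α γ d N τ₀) :
    ∃ τ, Admissible α γ d N τ ∧ ∀ τ', Admissible α γ d N τ' →
      Nstar α γ d N τ' ≤ Nstar α γ d N τ := by
  have hN1 : (1 : ℝ) < N := by exact_mod_cast hN
  have hlog : 0 < Real.log N := Real.log_pos hN1
  have hg : 0 < γ 0 ^ (1 / (2 * α)) := Real.rpow_pos_of_pos (hγ 0).1 _
  set a : ℝ := 4 / N
  set b : ℝ := N / (2 * γ 0 ^ (1 / (2 * α)) * Real.log N)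
  have ha : 0 < a := by positivity
  have hab (τ : ℝ) (h : Admissible α γ d N τ) : τ ∈ Set.Icc a b := by
    have hτ := h.1
    have hP := one_le_P (α := α) hγ d N hτ
    have h1 := h.mul_exp_le hγ
    have hτ' : 0 < τ⁻¹ := inv_pos.2 hτ
    constructor
    · have h2 : 4 * τ⁻¹ ≤ N := by
        have := Real.add_one_le_exp (4 * τ⁻¹)
        nlinarith
      rw [← div_eq_mul_inv, div_le_iff₀ hτ] at h2
      exact (div_le_iff₀' (by linarith)).2 h2
    · have h2 : P α γ d N τ ≤ N := by
        have := Real.one_le_exp (by positivity : 0 ≤ 4 * τ⁻¹)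
        nlinarith
      have h3 : 2 * γ 0 ^ (1 / (2 * α)) * (τ * Real.log N) ≤ P α γ d N τ := by
        unfold P
        rw [← Finset.mul_prod_erase _ _ (Finset.mem_univ (⟨0, hd⟩ : Fin d))]
        refine le_trans ?_ (le_mul_of_one_le_right (by positivity)
          (Finset.one_le_prod fun i _ => ?_))
        · simp only; nlinarith
        · have := Real.rpow_nonneg (hγ i).1.le (1 / (2 * α))
          have : 0 ≤ 2 * γ i ^ (1 / (2 * α)) * (1 + τ * Real.log N) := by positivity
          linarith
      rw [le_div_iff₀ (by positivity)]
      linarith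
  have hne (τ : ℝ) (hτ : τ ∈ Set.Icc a b) : τ ≠ 0 := (ha.trans_le hτ.1).ne'
  have hcP : Continuous fun τ => P α γ d N τ := by unfold P; fun_prop
  have hcinv : ContinuousOn (fun τ : ℝ => τ⁻¹) (Set.Icc a b) := continuousOn_inv₀.mono hne
  set F : ℝ → ℝ := fun τ => P α γ d N τ * Real.exp ((4 * τ⁻¹ + 4) / Real.exp (-1)) + 1 with hF
  have hcF : ContinuousOn F (Set.Icc a b) :=
    (hcP.continuousOn.mul (Real.continuous_exp.comp_continuousOn
      (((continuousOn_const.mul hcinv).add continuousOn_const).div_const _))).add continuousOn_const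
  have hcompact : IsCompact (Set.Icc a b ∩ F ⁻¹' Set.Iic N) :=
    isCompact_Icc.of_isClosed_subset
      (hcF.preimage_isClosed_of_isClosed isClosed_Icc isClosed_Iic) Set.inter_subset_left
  have hcN : ContinuousOn (fun τ => Nstar α γ d N τ) (Set.Icc a b) := by
    unfold Nstar
    refine continuousOn_const.div ((Real.continuous_exp.comp_continuousOn hcinv).mul
      hcP.continuousOn) fun τ hτ => ?_
    have := one_le_P (α := α) hγ d N (ha.trans_le hτ.1)
    have := Real.exp_pos τ⁻¹
    positivity
  obtain ⟨τ, hτ, hmax⟩ := hcompact.exists_isMaxOn ⟨τ₀, hab τ₀ h₀, h₀.2⟩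
    (hcN.mono Set.inter_subset_left)
  exact ⟨τ, ⟨ha.trans_le hτ.1.1, hτ.2⟩, fun τ' h' => hmax ⟨hab τ' h', h'.2⟩⟩

theorem P_le_exp {α : ℝ} {γ : ℕ → ℝ} (hγ : ∀ j, 0 < γ j ∧ γ j ≤ 1) (d N : ℕ) {τ : ℝ}
    (hτ : 0 < τ) : P α γ d N τ ≤
      Real.exp (2 * (∑ j ∈ Finset.range d, γ j ^ (1 / (2 * α))) * (1 + τ * Real.log N)) := by
  have hlog := Real.log_natCast_nonneg N
  rw [← Fin.sum_univ_eq_sum_range (fun j => γ j ^ (1 / (2 * α))), Finset.mul_sum, Finset.sum_mul,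
    Real.exp_sum]
  refine Finset.prod_le_prod (fun j _ => ?_) fun j _ => ?_
  · have := Real.rpow_nonneg (hγ j).1.le (1 / (2 * α))
    positivity
  · rw [add_comm]
    exact Real.add_one_le_exp _

/-- The growth rate of the threshold for `N` in `admissible_of_le`. -/
def growthRate (K ε : ℝ) : ℝ := 2 * K + 4 * Real.exp 1 * (2 * K / ε) + 4 * Real.exp 1

theorem growthRate_pos {K ε : ℝ} (hK : 0 < K) (hε : 0 < ε) : 0 < growthRate K ε := by
  unfold growthRate; positivity

/-- The value `τ = ε/(2KT)` is chosen so that the part of `log P` proportional to `log N` is at most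
`ε log N`. The rest of the exponent is linear in `T`, the constant `4e` being absorbed by `T ≥ 1`.
-/
theorem P_mul_exp_le {α : ℝ} {γ : ℕ → ℝ} (hγ : ∀ j, 0 < γ j ∧ γ j ≤ 1) {d N : ℕ}
    {K T ε : ℝ} (hK : 0 < K) (hT : 1 ≤ T)
    (hS : ∑ j ∈ Finset.range d, γ j ^ (1 / (2 * α)) ≤ K * T) (hε : 0 < ε)
    (hN : 1 ≤ N) :
    P α γ d N (ε / (2 * K * T)) *
        Real.exp ((4 * (ε / (2 * K * T))⁻¹ + 4) / Real.exp (-1)) ≤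
      Real.exp (growthRate K ε * T) * (N : ℝ) ^ ε := by
  have hN1 : (1 : ℝ) ≤ N := by exact_mod_cast hN
  have hlog := Real.log_natCast_nonneg N
  refine (mul_le_mul_of_nonneg_right (P_le_exp hγ d N (by positivity))
    (Real.exp_pos _).le).trans ?_
  rw [Real.rpow_def_of_pos (by linarith), ← Real.exp_add, ← Real.exp_add]
  refine Real.exp_le_exp.2 ?_
  have h1 : 2 * (∑ j ∈ Finset.range d, γ j ^ (1 / (2 * α))) *
      (1 + ε / (2 * K * T) * Real.log N) ≤ 2 * (K * T) * (1 + ε / (2 * K * T) * Real.log N) := by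
    gcongr
  have h2 : 2 * (K * T) * (1 + ε / (2 * K * T) * Real.log N) = 2 * K * T + Real.log N * ε := by
    field_simp
  have h3 : (4 * (ε / (2 * K * T))⁻¹ + 4) / Real.exp (-1) =
      4 * Real.exp 1 * (2 * K / ε) * T + 4 * Real.exp 1 := by
    rw [Real.exp_neg, div_inv_eq_mul, inv_div]
    field_simp
  rw [h3]
  unfold growthRate
  have : 4 * Real.exp 1 * 1 ≤ 4 * Real.exp 1 * T := by gcongr
  linarith

theorem two_mul_exp_mul_rpow_le {N : ℕ} {K T ε : ℝ} (hK : 0 < K) (hT : 1 ≤ T) (hε : 0 < ε)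
    (hε2 : ε ≤ 1 / 2)
    (hN : 4 * Real.exp (2 * growthRate K ε * T) ≤ N) :
    2 * (Real.exp (growthRate K ε * T) * (N : ℝ) ^ ε) ≤ N := by
  have ha := growthRate_pos hK hε
  have hN1 : (1 : ℝ) ≤ N := by
    have := Real.one_le_exp (by positivity : 0 ≤ 2 * growthRate K ε * T)
    linarith
  have h1 : 2 * Real.exp (growthRate K ε * T) ≤ (N : ℝ) ^ (1 / 2 : ℝ) := by
    rw [← Real.sqrt_eq_rpow]
    refine Real.le_sqrt_of_sq_le ?_
    rw [mul_pow, ← Real.exp_nat_mul]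
    refine le_trans (le_of_eq ?_) hN
    norm_num
    ring
  calc 2 * (Real.exp (growthRate K ε * T) * (N : ℝ) ^ ε)
      = 2 * Real.exp (growthRate K ε * T) * (N : ℝ) ^ ε := by ring
    _ ≤ (N : ℝ) ^ (1 / 2 : ℝ) * (N : ℝ) ^ (1 / 2 : ℝ) := by
        gcongr
    _ = N := by
        rw [← Real.rpow_add (by linarith)]; norm_num

theorem admissible_of_le {α : ℝ} {γ : ℕ → ℝ} (hγ : ∀ j, 0 < γ j ∧ γ j ≤ 1) {d N : ℕ}
    {K T ε : ℝ} (hK : 0 < K) (hT : 1 ≤ T)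
    (hS : ∑ j ∈ Finset.range d, γ j ^ (1 / (2 * α)) ≤ K * T) (hε : 0 < ε)
    (hε2 : ε ≤ 1 / 2) (hN : 4 * Real.exp (2 * growthRate K ε * T) ≤ N) :
    Admissible α γ d N (ε / (2 * K * T)) := by
  have ha := growthRate_pos hK hε
  have hN4 : (4 : ℝ) ≤ N := by
    have := Real.one_le_exp (by positivity : 0 ≤ 2 * growthRate K ε * T)
    linarith
  have h1 := P_mul_exp_le hγ hK hT hS hε (N := N) (by exact_mod_cast (by linarith : (1 : ℝ) ≤ N))
  have h2 := two_mul_exp_mul_rpow_le hK hT hε hε2 hN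
  exact ⟨by positivity, by linarith⟩

/-- Above the threshold of `admissible_of_le`, the explicit `σ = ε/(2KT)` is admissible and
maximality compares `τ` with it. Below the threshold `N` itself is bounded by the constant, and
admissibility gives `N_* ≥ 1`. -/
theorem rpow_le_mul_Nstar {α : ℝ} {γ : ℕ → ℝ} (hγ : ∀ j, 0 < γ j ∧ γ j ≤ 1) {d N : ℕ}
    {K T ε : ℝ} (hK : 0 < K) (hT : 1 ≤ T)
    (hS : ∑ j ∈ Finset.range d, γ j ^ (1 / (2 * α)) ≤ K * T) (hε : 0 < ε)
    (hε2 : ε ≤ 1 / 2) (hN : 1 ≤ N) {τ : ℝ} (h : Admissible α γ d N τ)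
    (hmax : ∀ τ', Admissible α γ d N τ' → Nstar α γ d N τ' ≤ Nstar α γ d N τ) :
    (N : ℝ) ^ (1 - ε) ≤ 4 * Real.exp (2 * growthRate K ε * T) * Nstar α γ d N τ := by
  have ha := growthRate_pos hK hε
  have hN1 : (1 : ℝ) ≤ N := by exact_mod_cast hN
  have hexp := Real.one_le_exp (by positivity : 0 ≤ growthRate K ε * T)
  rcases le_total (4 * Real.exp (2 * growthRate K ε * T)) N with hlarge | hsmall
  · have hadm := admissible_of_le hγ hK hT hS hε hε2 hlarge
    set σ := ε / (2 * K * T)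
    have hP := one_le_P (α := α) hγ d N hadm.1
    have h1 : Real.exp σ⁻¹ * P α γ d N σ ≤ Real.exp (growthRate K ε * T) * (N : ℝ) ^ ε := by
      refine le_trans ?_ (P_mul_exp_le hγ hK hT hS hε hN)
      rw [mul_comm]
      gcongr
      have h2 : 0 < σ⁻¹ := inv_pos.2 hadm.1
      rw [le_div_iff₀ (Real.exp_pos _)]
      have : Real.exp (-1) ≤ 1 := Real.exp_le_one_iff.2 (by norm_num)
      nlinarith
    have h2 : (N : ℝ) / 2 ≤ N - 1 := by
      have := Real.one_le_exp (by positivity : 0 ≤ 2 * growthRate K ε * T)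
      linarith
    have h3 : (N : ℝ) / 2 / (Real.exp (growthRate K ε * T) * (N : ℝ) ^ ε) ≤ Nstar α γ d N τ := by
      refine le_trans ?_ (hmax σ hadm)
      unfold Nstar
      gcongr
    rw [div_le_iff₀ (by positivity)] at h3
    have h4 : (N : ℝ) ^ (1 - ε) * (N : ℝ) ^ ε = N := by
      rw [← Real.rpow_add (by linarith)]; simp
    have hNε : 0 < (N : ℝ) ^ ε := by positivity
    have hL := h.one_le_Nstar hγ
    refine le_of_mul_le_mul_right ?_ hNε
    rw [h4]
    calc (N : ℝ) ≤ 2 * (Nstar α γ d N τ * (Real.exp (growthRate K ε * T) * (N : ℝ) ^ ε)) := by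
          linarith
      _ ≤ 4 * (Nstar α γ d N τ * (Real.exp (2 * growthRate K ε * T) * (N : ℝ) ^ ε)) := by
          gcongr
          · norm_num
          · linarith
      _ = _ := by ring
  · calc (N : ℝ) ^ (1 - ε) ≤ (N : ℝ) ^ (1 : ℝ) :=
          Real.rpow_le_rpow_of_exponent_le hN1 (by linarith)
      _ = N := Real.rpow_one _
      _ ≤ _ := hsmall
      _ ≤ _ := le_mul_of_one_le_right (by positivity) (h.one_le_Nstar hγ)

/-! ### Existence of a parameter choice -/

theorem isGreatest_prime_exists {δ : ℝ} (hδ₀ : 0 < δ) (hδ₁ : δ < 1) {B p : ℕ} (hp : p.Prime)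
    (hB : (p : ℝ) * (repCentre δ p + 1) ≤ B) :
    ∃ N, p ≤ N ∧ IsGreatest {p : ℕ | p.Prime ∧ (p : ℝ) * (repCentre δ p + 1) ≤ B} N := by
  have hbdd : BddAbove {p : ℕ | p.Prime ∧ (p : ℝ) * (repCentre δ p + 1) ≤ B} := by
    refine ⟨B, fun q hq => ?_⟩
    have h1 := repCentre_nonneg hδ₀ hδ₁ hq.1.one_le
    have h2 : (q : ℝ) ≤ B :=
      (le_mul_of_one_le_right (Nat.cast_nonneg q) (by linarith)).trans hq.2
    exact_mod_cast h2
  exact ⟨_, le_csSup hbdd ⟨hp, hB⟩, Nat.sSup_mem ⟨p, hp, hB⟩ hbdd, fun q hq => le_csSup hbdd hq⟩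

theorem exists_isParameterChoice {α : ℝ} {γ : ℕ → ℝ} (hγ : ∀ j, 0 < γ j ∧ γ j ≤ 1) {δ : ℝ}
    (hδ₀ : 0 < δ) (hδ₁ : δ < 1) {K : ℝ} (hK : 0 < K) :
    ∃ (c : ℝ) (q : ℕ), ∀ d : ℕ, 1 ≤ d → ∀ T : ℝ, 1 ≤ T →
      ∑ j ∈ Finset.range d, γ j ^ (1 / (2 * α)) ≤ K * T → ∀ B : ℕ, c * Real.exp (q * T) ≤ B →
        ∃ (N m : ℕ) (τ : ℝ), IsParameterChoice α γ δ d B N m τ := by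
  set a := growthRate K (1 / 2)
  have ha : 0 < a := growthRate_pos hK (by norm_num)
  have hδ := log_inv_pos hδ₀ hδ₁
  -- Bertrand's postulate gives a prime `p ≤ 4X` with `X = 4 exp(2aT)`, so `p² ≤ 256 exp(4aT)`; the
  -- crude bound `log p ≤ p - 1` makes the budget for `p` at most `(3 + 2 log δ⁻¹) p²`.
  refine ⟨256 * (3 + 2 * Real.log δ⁻¹), ⌈4 * a⌉₊, fun d hd T hT hS B hB => ?_⟩
  set X := 4 * Real.exp (2 * a * T) with hX
  have hX4 : 4 ≤ X := by
    have := Real.one_le_exp (by positivity : 0 ≤ 2 * a * T)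
    linarith
  obtain ⟨p, hp, hnp, hpn⟩ := Nat.exists_prime_lt_and_le_two_mul ⌈X⌉₊
    (Nat.ceil_pos.2 (by linarith)).ne'
  have hXp : X ≤ p := (Nat.le_ceil X).trans (by exact_mod_cast hnp.le)
  have hpX : (p : ℝ) ≤ 4 * X := by
    have h1 : (p : ℝ) ≤ 2 * (⌈X⌉₊ : ℝ) := by exact_mod_cast hpn
    have h2 := Nat.ceil_lt_add_one (by linarith : 0 ≤ X)
    linarith
  have hp1 : (1 : ℝ) ≤ p := by linarith
  have hpB : (p : ℝ) * (repCentre δ p + 1) ≤ B := by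
    have h1 := repCentre_le δ hp.one_le
    have h2 := Real.log_le_sub_one_of_pos (by linarith : (0 : ℝ) < p)
    have h3 : repCentre δ p + 1 ≤ (3 + 2 * Real.log δ⁻¹) * p := by
      nlinarith
    calc (p : ℝ) * (repCentre δ p + 1) ≤ p * ((3 + 2 * Real.log δ⁻¹) * p) := by gcongr
      _ ≤ (4 * X) * ((3 + 2 * Real.log δ⁻¹) * (4 * X)) := by gcongr
      _ = 256 * (3 + 2 * Real.log δ⁻¹) * Real.exp (4 * a * T) := by
        have : Real.exp (4 * a * T) = Real.exp (2 * a * T) * Real.exp (2 * a * T) := by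
          rw [← Real.exp_add]; ring_nf
        rw [this, hX]; ring
      _ ≤ 256 * (3 + 2 * Real.log δ⁻¹) * Real.exp (⌈4 * a⌉₊ * T) := by
        gcongr
        exact Nat.le_ceil _
      _ ≤ B := hB
  obtain ⟨N, hpN, hN⟩ := isGreatest_prime_exists hδ₀ hδ₁ hp hpB
  have hadm := admissible_of_le hγ hK hT hS (by norm_num : (0 : ℝ) < 1 / 2) le_rfl
    (hXp.trans (by exact_mod_cast hpN) : X ≤ (N : ℝ))
  obtain ⟨τ, hτ, hmax⟩ := exists_maximal_Nstar hγ hd hN.1.1.two_le hadm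
  have hρ := repCentre_nonneg hδ₀ hδ₁ hN.1.1.one_le
  have hm1 := Nat.floor_le (by positivity : 0 ≤ repCentre δ N / 2)
  have hm2 := Nat.lt_floor_add_one (repCentre δ N / 2)
  -- With this `m`, the odd number `2m + 1` lies in the half-open interval from `ρ - 1` to `ρ + 1`.
  refine ⟨N, ⌊repCentre δ N / 2⌋₊, τ, hN, ?_, ?_, hτ, hmax⟩
  · push_cast; linarith
  · push_cast; linarith

/-! ### The error bound for a parameter choice -/

/-- The `4` in `η = e^{-2α}/4` cancels the `4^m` choices of bad samples, leaving `2 e^{-2αm}`. -/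
theorem two_pow_mul_pow_le {α : ℝ} (hα : 1 / 2 < α) {δ : ℝ} (hδ₀ : 0 < δ) (hδ₁ : δ < 1) {N m : ℕ}
    (hN : 1 ≤ N) (hm : repCentre δ N - 1 ≤ ((2 * m + 1 : ℕ) : ℝ)) :
    2 ^ (2 * m + 1) * (Real.exp (-(2 * α)) / 4) ^ m ≤
      2 * Real.exp (2 * α * (Real.log (4 * Real.exp 1) + 1)) * (N : ℝ) ^ (-(2 * α)) := by
  have h1 := log_le_of_repCentre_le hδ₀ hδ₁ hN hm
  have hN1 : (1 : ℝ) ≤ N := by exact_mod_cast hN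
  have h2 : (2 : ℝ) ^ (2 * m + 1) * (Real.exp (-(2 * α)) / 4) ^ m =
      2 * Real.exp (-(2 * α) * m) := by
    rw [pow_succ, pow_mul, mul_comm (-(2 * α)), Real.exp_nat_mul, div_pow]
    norm_num
    field_simp
  rw [h2, Real.rpow_def_of_pos (by linarith), mul_assoc, ← Real.exp_add]
  gcongr
  nlinarith

theorem randomizedError_le_sqrt_mul {α : ℝ} (hα : 1 / 2 < α) {γ : ℕ → ℝ}
    (hγ : ∀ j, 0 < γ j ∧ γ j ≤ 1) {δ : ℝ} (hδ₀ : 0 < δ) (hδ₁ : δ < 1) :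
    ∃ C : ℝ, 0 < C ∧ ∀ (d N m : ℕ) (τ : ℝ), N.Prime →
      repCentre δ N - 1 ≤ ((2 * m + 1 : ℕ) : ℝ) → 0 < τ →
      randomizedError α γ d N m τ ≤ ENNReal.ofReal
        (C * (((2 * m + 1 : ℕ) : ℝ) ^ (1 / 2 : ℝ) * Nstar α γ d N τ ^ (-α))) := by
  set η : ℝ := Real.exp (-(2 * α)) / 4
  have hη : 0 < η := by positivity
  have hη1 : η ≤ 1 := by
    have : Real.exp (-(2 * α)) ≤ 1 := Real.exp_le_one_iff.2 (by linarith)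
    simp only [η]; linarith
  set D := Real.exp (2 * α * (Real.log (4 * Real.exp 1) + 1))
  set C2 : ℝ := 1 + 2 * η ^ (-(2 * α)) + 4 * D
  have hC2 : 0 < C2 := by positivity
  refine ⟨Real.sqrt C2, Real.sqrt_pos.2 hC2, fun d N m τ hN hm hτ => ?_⟩
  have hN1 : (1 : ℝ) < N := by exact_mod_cast hN.one_lt
  have hLN := Nstar_le (α := α) hγ d hN.one_le hτ
  have hL0 : 0 < Nstar α γ d N τ := by
    have := one_le_P (α := α) hγ d N hτ
    exact div_pos (by linarith) (by positivity)
  have h2 := two_pow_mul_pow_le hα hδ₀ hδ₁ hN.one_le hm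
  have hR : (1 : ℝ) ≤ ((2 * m + 1 : ℕ) : ℝ) := by exact_mod_cast Nat.le_add_left 1 (2 * m)
  refine randomizedError_le hα hγ hN hτ hη hη1 (by positivity) ?_
  set R : ℝ := ((2 * m + 1 : ℕ) : ℝ)
  set L := Nstar α γ d N τ
  have h3 : (N : ℝ) ^ (-(2 * α)) ≤ L ^ (-(2 * α)) :=
    Real.rpow_le_rpow_of_nonpos hL0 (by linarith) (by linarith)
  have h4 : (Real.sqrt C2 * (R ^ (1 / 2 : ℝ) * L ^ (-α))) ^ 2 = C2 * (R * L ^ (-(2 * α))) := by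
    rw [mul_pow, mul_pow, Real.sq_sqrt hC2.le, ← Real.rpow_natCast, ← Real.rpow_natCast,
      ← Real.rpow_mul (by linarith), ← Real.rpow_mul hL0.le, Nat.cast_ofNat,
      div_mul_cancel₀ _ two_ne_zero, Real.rpow_one, neg_mul, mul_comm α]
  rw [h4, Real.mul_rpow hη.le hL0.le]
  have hLp : 0 < L ^ (-(2 * α)) := Real.rpow_pos_of_pos hL0 _
  calc L ^ (-(2 * α)) + (R * (2 * (η ^ (-(2 * α)) * L ^ (-(2 * α)))) +
        R * (2 ^ (2 * m + 1) * η ^ m) * 2)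
      ≤ R * L ^ (-(2 * α)) + (R * (2 * (η ^ (-(2 * α)) * L ^ (-(2 * α)))) +
        R * (2 * D * L ^ (-(2 * α))) * 2) := by
        have hR0 : 0 ≤ R := zero_le_one.trans hR
        have h5 : 2 ^ (2 * m + 1) * η ^ m ≤ 2 * D * L ^ (-(2 * α)) := h2.trans (by gcongr)
        have h6 : L ^ (-(2 * α)) ≤ R * L ^ (-(2 * α)) := le_mul_of_one_le_left hLp.le hR
        have h7 := mul_le_mul_of_nonneg_left h5 hR0
        linarith
    _ = C2 * (R * L ^ (-(2 * α))) := by ring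

theorem randomizedError_le_of_isParameterChoice {α : ℝ} (hα : 1 / 2 < α) {γ : ℕ → ℝ}
    (hγ : ∀ j, 0 < γ j ∧ γ j ≤ 1) {δ : ℝ} (hδ₀ : 0 < δ) (hδ₁ : δ < 1) {K : ℝ} (hK : 0 < K)
    {ε : ℝ} (hε : 0 < ε) :
    ∃ (C : ℝ) (q : ℕ), ∀ (d : ℕ) (T : ℝ), 1 ≤ T →
      ∑ j ∈ Finset.range d, γ j ^ (1 / (2 * α)) ≤ K * T → ∀ (B N m : ℕ) (τ : ℝ),
        IsParameterChoice α γ δ d B N m τ →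
        randomizedError α γ d N m τ ≤ ENNReal.ofReal
          (C * Real.exp (q * T) * (((2 * m + 1) * N : ℕ) : ℝ) ^ (-α + ε)) := by
  have hα0 : 0 < α := by linarith
  obtain ⟨C₀, hC₀, hmain⟩ := randomizedError_le_sqrt_mul hα hγ hδ₀ hδ₁
  -- Half of `ε` pays for `N_*` in place of `N`, as `α ε₁ ≤ ε/2`; the other half pays for the
  -- repetitions, since `κ` below satisfies `(1/2 + α) κ = ε/2`.
  set ε₁ := min (1 / 2) (ε / (2 * α))
  have hε₁ : 0 < ε₁ := lt_min (by norm_num) (by positivity)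
  set a := growthRate K ε₁
  have ha : 0 < a := growthRate_pos hK hε₁
  set κ := ε / (1 + 2 * α)
  have hκ : 0 < κ := by positivity
  have hδ := log_inv_pos hδ₀ hδ₁
  set C₁ := 2 / κ + 2 * Real.log δ⁻¹ + 1
  have hC₁ : 0 < C₁ := by positivity
  refine ⟨C₀ * (C₁ ^ (1 / 2 + α) * 4 ^ α), ⌈2 * a * α⌉₊, fun d T hT hS B N m τ h => ?_⟩
  have hN := h.isGreatest_prime.1.1
  have hN1 : (1 : ℝ) < N := by exact_mod_cast hN.one_lt
  have hN0 : (0 : ℝ) < N := by linarith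
  refine (hmain d N m τ hN h.repCentre_sub_one_le h.admissible.1).trans
    (ENNReal.ofReal_le_ofReal ?_)
  have hL1 := h.admissible.one_le_Nstar hγ
  have hL := rpow_le_mul_Nstar hγ hK hT hS hε₁ (min_le_left _ _) hN.one_le h.admissible h.maximal
  have hRC := h.le_repCentre_add_one.trans (repCentre_add_one_le_rpow hδ₀ hδ₁ hκ hN.one_le)
  have hR1 : (1 : ℝ) ≤ ((2 * m + 1 : ℕ) : ℝ) := by exact_mod_cast Nat.le_add_left 1 (2 * m)
  rw [Nat.cast_mul]
  set R : ℝ := ((2 * m + 1 : ℕ) : ℝ)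
  set L := Nstar α γ d N τ
  have hR0 : 0 < R := by linarith
  have hL0 : 0 < L := by linarith
  -- The factor `R^{-α}` is split off because the target is a power of `M = RN`, not of `N`; the
  -- surplus `R^{1/2 + α}` is absorbed through `R ≤ C₁ N^κ`.
  have hR : R ^ (1 / 2 : ℝ) ≤ C₁ ^ (1 / 2 + α) * (N : ℝ) ^ (ε / 2) * R ^ (-α) := by
    calc R ^ (1 / 2 : ℝ) = R ^ (1 / 2 + α) * R ^ (-α) := by
          rw [← Real.rpow_add hR0]; ring_nf
      _ ≤ (C₁ * (N : ℝ) ^ κ) ^ (1 / 2 + α) * R ^ (-α) := by gcongr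
      _ = _ := by
          rw [Real.mul_rpow hC₁.le (by positivity), ← Real.rpow_mul hN0.le]
          congr 3
          simp only [κ]
          field_simp
  have hL' : L ^ (-α) ≤ 4 ^ α * Real.exp (2 * a * α * T) * ((N : ℝ) ^ (-α) * (N : ℝ) ^ (ε / 2)) := by
    have h1 : (N : ℝ) ^ (1 - ε₁) / (4 * Real.exp (2 * a * T)) ≤ L := by
      rw [div_le_iff₀ (by positivity), mul_comm]; exact hL
    calc L ^ (-α) ≤ ((N : ℝ) ^ (1 - ε₁) / (4 * Real.exp (2 * a * T))) ^ (-α) :=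
          Real.rpow_le_rpow_of_nonpos (by positivity) h1 (by linarith)
      _ = 4 ^ α * Real.exp (2 * a * α * T) * (N : ℝ) ^ (-α + α * ε₁) := by
          rw [Real.div_rpow (by positivity) (by positivity), ← Real.rpow_mul hN0.le,
            Real.rpow_neg (by positivity), div_inv_eq_mul, mul_comm,
            Real.mul_rpow (by norm_num) (by positivity), ← Real.exp_mul]
          ring_nf
      _ ≤ _ := by
          rw [← Real.rpow_add hN0]
          gcongr
          · exact hN1.le
          · calc α * ε₁ ≤ α * (ε / (2 * α)) := by gcongr; exact min_le_right _ _
              _ = ε / 2 := by field_simp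
  calc C₀ * (R ^ (1 / 2 : ℝ) * L ^ (-α))
      ≤ C₀ * ((C₁ ^ (1 / 2 + α) * (N : ℝ) ^ (ε / 2) * R ^ (-α)) *
          (4 ^ α * Real.exp (2 * a * α * T) * ((N : ℝ) ^ (-α) * (N : ℝ) ^ (ε / 2)))) := by
        gcongr
    _ = C₀ * (C₁ ^ (1 / 2 + α) * 4 ^ α) * Real.exp (2 * a * α * T) *
          ((R * N) ^ (-α) * ((N : ℝ) ^ (ε / 2) * (N : ℝ) ^ (ε / 2))) := by
        rw [Real.mul_rpow hR0.le hN0.le]; ring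
    _ ≤ C₀ * (C₁ ^ (1 / 2 + α) * 4 ^ α) * Real.exp (⌈2 * a * α⌉₊ * T) *
          ((R * N) ^ (-α) * (R * N) ^ ε) := by
        rw [← Real.rpow_add hN0, add_halves]
        gcongr
        · exact Nat.le_ceil _
        · exact le_mul_of_one_le_left hN0.le hR1
    _ = _ := by rw [← Real.rpow_add (by positivity)]

/-- The limsup controls only large `d`; the finitely many others are covered by the partial sum up
to `n`. Using `1 + log d` avoids the zero of the logarithm at `d = 1` and serves as a `T ≥ 1`. -/
theorem exists_sum_le_mul_one_add_log {g : ℕ → ℝ} (hg : ∀ j, 0 ≤ g j)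
    (h : limsup (fun d : ℕ => (((∑ j ∈ Finset.range d, g j) / Real.log d : ℝ) : EReal)) atTop < ⊤) :
    ∃ K : ℝ, 0 < K ∧ ∀ d : ℕ, 1 ≤ d →
      ∑ j ∈ Finset.range d, g j ≤ K * (1 + Real.log d) := by
  obtain ⟨b, hb, hb'⟩ := EReal.lt_iff_exists_real_btwn.1 h
  obtain ⟨n, hn⟩ := eventually_atTop.1 ((eventually_lt_of_limsup_lt hb).and
    (eventually_ge_atTop 2))
  have hS (d : ℕ) : 0 ≤ ∑ j ∈ Finset.range d, g j := Finset.sum_nonneg fun j _ => hg j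
  refine ⟨|b| + ∑ j ∈ Finset.range n, g j + 1, by have := hS n; positivity, fun d hd => ?_⟩
  have hlog := Real.log_natCast_nonneg d
  rcases le_total d n with hdn | hdn
  · calc ∑ j ∈ Finset.range d, g j ≤ ∑ j ∈ Finset.range n, g j :=
          Finset.sum_le_sum_of_subset_of_nonneg (Finset.range_mono hdn) fun j _ _ => hg j
      _ ≤ (|b| + ∑ j ∈ Finset.range n, g j + 1) * 1 := by linarith [abs_nonneg b]
      _ ≤ _ := by
          have := hS n
          gcongr
          linarith
  · obtain ⟨h1, h2⟩ := hn d hdn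
    have hlog' : 0 < Real.log d := Real.log_pos (by exact_mod_cast h2)
    have h3 : (∑ j ∈ Finset.range d, g j) / Real.log d < b := by exact_mod_cast h1
    rw [div_lt_iff₀ hlog'] at h3
    have := hS n
    nlinarith [le_abs_self b, abs_nonneg b]

theorem exp_mul_one_add_log (q : ℕ) {d : ℕ} (hd : 1 ≤ d) :
    Real.exp (q * (1 + Real.log d)) = Real.exp q * (d : ℝ) ^ q := by
  have : (0 : ℝ) < d := by exact_mod_cast hd
  rw [mul_add, mul_one, Real.exp_add, Real.exp_nat_mul, Real.exp_log this]

end MedianLattice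

end

theorem mainTheorem5 (α : ℝ) (hα : 1 / 2 < α) (γ : ℕ → ℝ) (hγ : ∀ j, 0 < γ j ∧ γ j ≤ 1)
    (δ : ℝ) (hδ₀ : 0 < δ) (hδ₁ : δ < 1) :
    -- arbitrary weights, fixed dimension
    (∀ d : ℕ, 1 ≤ d →
      (∃ B₀ : ℝ, ∀ B : ℕ, B₀ ≤ B →
        ∃ (N m : ℕ) (τ : ℝ), MedianLattice.IsParameterChoice α γ δ d B N m τ) ∧
      ∀ ε : ℝ, 0 < ε → ∃ C : ℝ, ∀ (B N m : ℕ) (τ : ℝ),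
        MedianLattice.IsParameterChoice α γ δ d B N m τ →
        MedianLattice.randomizedError α γ d N m τ ≤
          ENNReal.ofReal (C * (((2 * m + 1) * N : ℕ) : ℝ) ^ (-α + ε))) ∧
    -- summable weights: nothing depends on the dimension
    (Summable (fun j => γ j ^ (1 / (2 * α))) →
      (∃ B₀ : ℝ, ∀ d : ℕ, 1 ≤ d → ∀ B : ℕ, B₀ ≤ B →
        ∃ (N m : ℕ) (τ : ℝ), MedianLattice.IsParameterChoice α γ δ d B N m τ) ∧
      ∀ ε : ℝ, 0 < ε → ∃ C : ℝ, ∀ d : ℕ, 1 ≤ d → ∀ (B N m : ℕ) (τ : ℝ),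
        MedianLattice.IsParameterChoice α γ δ d B N m τ →
        MedianLattice.randomizedError α γ d N m τ ≤
          ENNReal.ofReal (C * (((2 * m + 1) * N : ℕ) : ℝ) ^ (-α + ε))) ∧
    -- logarithmically growing partial sums: polynomial dependence on the dimension
    (limsup (fun d : ℕ => (((∑ j ∈ Finset.range d, γ j ^ (1 / (2 * α))) / Real.log d : ℝ) : EReal))
        atTop < ⊤ →
      (∃ (B₀ : ℝ) (q : ℕ), ∀ d : ℕ, 1 ≤ d → ∀ B : ℕ, B₀ * (d : ℝ) ^ q ≤ B →
        ∃ (N m : ℕ) (τ : ℝ), MedianLattice.IsParameterChoice α γ δ d B N m τ) ∧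
      ∀ ε : ℝ, 0 < ε → ∃ (C : ℝ) (q : ℕ), ∀ d : ℕ, 1 ≤ d → ∀ (B N m : ℕ) (τ : ℝ),
        MedianLattice.IsParameterChoice α γ δ d B N m τ →
        MedianLattice.randomizedError α γ d N m τ ≤
          ENNReal.ofReal (C * (d : ℝ) ^ q * (((2 * m + 1) * N : ℕ) : ℝ) ^ (-α + ε))) := by
  have hg (j : ℕ) : 0 ≤ γ j ^ (1 / (2 * α)) := Real.rpow_nonneg (hγ j).1.le _
  refine ⟨fun d hd => ?_, fun hsum => ?_, fun hlim => ?_⟩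
  · have hK : 0 < ∑ j ∈ Finset.range d, γ j ^ (1 / (2 * α)) + 1 := by
      have := Finset.sum_nonneg fun j (_ : j ∈ Finset.range d) => hg j
      linarith
    have hS : ∑ j ∈ Finset.range d, γ j ^ (1 / (2 * α)) ≤
        (∑ j ∈ Finset.range d, γ j ^ (1 / (2 * α)) + 1) * 1 := by linarith
    obtain ⟨c, q, h⟩ := MedianLattice.exists_isParameterChoice (α := α) hγ hδ₀ hδ₁ hK
    refine ⟨⟨_, h d hd 1 le_rfl hS⟩, fun ε hε => ?_⟩
    obtain ⟨C, q, h⟩ := MedianLattice.randomizedError_le_of_isParameterChoice hα hγ hδ₀ hδ₁ hK hε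
    exact ⟨_, h d 1 le_rfl hS⟩
  · have hK : 0 < ∑' j, γ j ^ (1 / (2 * α)) + 1 := by
      have : 0 ≤ ∑' j, γ j ^ (1 / (2 * α)) := tsum_nonneg hg
      linarith
    have hS (d : ℕ) : ∑ j ∈ Finset.range d, γ j ^ (1 / (2 * α)) ≤
        (∑' j, γ j ^ (1 / (2 * α)) + 1) * 1 := by
      have := hsum.sum_le_tsum (Finset.range d) fun j _ => hg j
      linarith
    obtain ⟨c, q, h⟩ := MedianLattice.exists_isParameterChoice (α := α) hγ hδ₀ hδ₁ hK
    refine ⟨⟨_, fun d hd => h d hd 1 le_rfl (hS d)⟩, fun ε hε => ?_⟩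
    obtain ⟨C, q, h⟩ := MedianLattice.randomizedError_le_of_isParameterChoice hα hγ hδ₀ hδ₁ hK hε
    exact ⟨_, fun d _ => h d 1 le_rfl (hS d)⟩
  · obtain ⟨K, hK, hS⟩ := MedianLattice.exists_sum_le_mul_one_add_log hg hlim
    have hT (d : ℕ) : 1 ≤ 1 + Real.log d := by linarith [Real.log_natCast_nonneg d]
    obtain ⟨c, q, h⟩ := MedianLattice.exists_isParameterChoice (α := α) hγ hδ₀ hδ₁ hK
    -- Here `T = 1 + log d`, so `exp(qT) = e^q d^q`.
    refine ⟨⟨c * Real.exp q, q, fun d hd B hB => h d hd _ (hT d) (hS d hd) B ?_⟩, fun ε hε => ?_⟩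
    · rwa [MedianLattice.exp_mul_one_add_log q hd, ← mul_assoc]
    · obtain ⟨C, q, h⟩ := MedianLattice.randomizedError_le_of_isParameterChoice hα hγ hδ₀ hδ₁ hK hε
      refine ⟨C * Real.exp q, q, fun d hd B N m τ hc => ?_⟩
      have := h d _ (hT d) (hS d hd) B N m τ hc
      rwa [MedianLattice.exp_mul_one_add_log q hd, ← mul_assoc] at this
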